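/- Let $H$ and $G$ be the groups given by the presentations $$H=\langle a,b,s \mid b^{-1}ab=a,\ s^{-1}a^2s=a^4\rangle,$$ $$G=\langle a,b,s,t \mid b^{-1}ab=a,\ s^{-1}a^2s=a^4,\ t^{-1}at=a^2,\ t^{-1}bt=b,\ t^{-1}st=s^{-1}bs^2\rangle.$$ Call a group Hopfian if every surjective endomorphism of it is an automorphism. Then $H$ is a finitely presented Hopfian group, and $G$ is a non-Hopfian ascending HNN-extension of $H$. More precisely: 1. $H$ is finitely presented and Hopfian. 2. There is an injective endomorphism $\varphi\colon H\to H$ with $\varphi(a)=a^2$, $\varphi(b)=b$, $\varphi(s)=s^{-1}bs^2$, and $G$ is isomorphic to the ascending HNN-extension $\langle H,t \mid t^{-1}ht=\varphi(h)\text{ for all } h\in H\rangle$ by an isomorphism that takes the generators $a,b,s$ of $G$ to the elements $a,b,s$ of $H$ and $t$ to the stable letter $t$. 3. $G$ is not Hopfian. -/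

import Mathlib

/-- A group is Hopfian if every surjective endomorphism of it is an automorphism. -/
def IsHopfianGroup (G : Type*) [Group G] : Prop :=
  ∀ f : G →* G, Function.Surjective f → Function.Bijective f

/-- The ascending HNN-extension `⟨H, t ∣ t⁻¹ h t = φ h for all h ∈ H⟩` of an injective
endomorphism `φ` of `H`. In Mathlib's convention the stable letter of
`HNNExtension H A B θ` satisfies `t x t⁻¹ = θ x` for `x ∈ A`; here `A = φ(H)`, `B = H`, and
`θ = φ⁻¹ : φ(H) ≃ H`, so that `t (φ h) t⁻¹ = h` (see `AscendingHNN.conj`). -/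
abbrev AscendingHNN {H : Type*} [Group H] (φ : H →* H) (hφ : Function.Injective φ) : Type _ :=
  HNNExtension H φ.range ⊤
    ((MonoidHom.ofInjective hφ).symm.trans Subgroup.topEquiv.symm)

/-- The defining relation of the ascending HNN-extension. -/
theorem AscendingHNN.conj {H : Type*} [Group H] (φ : H →* H) (hφ : Function.Injective φ) (h : H) :
    (HNNExtension.t : AscendingHNN φ hφ)⁻¹ * HNNExtension.of h * HNNExtension.t =
      HNNExtension.of (φ h) := by
  have key := HNNExtension.t_mul_of (G := H) (A := φ.range) (B := ⊤)
    (φ := (MonoidHom.ofInjective hφ).symm.trans Subgroup.topEquiv.symm)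
    (MonoidHom.ofInjective hφ h)
  simp only [MulEquiv.trans_apply, MulEquiv.symm_apply_apply, MonoidHom.ofInjective_apply,
    Subgroup.topEquiv_symm_apply_coe] at key
  rw [mul_assoc, ← key, inv_mul_cancel_left]

/-- The generators `a, b, s` of `H`. -/
inductive HGen : Type
  | a
  | b
  | s

/-- The relators of `H`, for the relations `b⁻¹ a b = a` and `s⁻¹ a² s = a⁴`. -/
def HRels : Set (FreeGroup HGen) :=
  let a := FreeGroup.of HGen.a
  let b := FreeGroup.of HGen.b
  let s := FreeGroup.of HGen.s
  {b⁻¹ * a * b * a⁻¹,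
   s⁻¹ * a ^ 2 * s * (a ^ 4)⁻¹}

/-- The group `H = ⟨a, b, s ∣ b⁻¹ a b = a, s⁻¹ a² s = a⁴⟩`. -/
abbrev HGroup : Type := PresentedGroup HRels

/-- The generators `a, b, s, t` of `G`. -/
inductive GGen : Type
  | a
  | b
  | s
  | t

/-- The relators of `G`, for the relations `b⁻¹ a b = a`, `s⁻¹ a² s = a⁴`, `t⁻¹ a t = a²`,
`t⁻¹ b t = b` and `t⁻¹ s t = s⁻¹ b s²`. -/
def GRels : Set (FreeGroup GGen) :=
  let a := FreeGroup.of GGen.a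
  let b := FreeGroup.of GGen.b
  let s := FreeGroup.of GGen.s
  let t := FreeGroup.of GGen.t
  {b⁻¹ * a * b * a⁻¹,
   s⁻¹ * a ^ 2 * s * (a ^ 4)⁻¹,
   t⁻¹ * a * t * (a ^ 2)⁻¹,
   t⁻¹ * b * t * b⁻¹,
   t⁻¹ * s * t * (s⁻¹ * b * s ^ 2)⁻¹}

/-- The group `G = ⟨a, b, s, t ∣ b⁻¹ a b = a, s⁻¹ a² s = a⁴, t⁻¹ a t = a², t⁻¹ b t = b,
t⁻¹ s t = s⁻¹ b s²⟩`. -/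
abbrev GGroup : Type := PresentedGroup GRels

/-- The generator `a` of `H`. -/
def HGroup.a : HGroup := PresentedGroup.of HGen.a

/-- The generator `b` of `H`. -/
def HGroup.b : HGroup := PresentedGroup.of HGen.b

/-- The generator `s` of `H`. -/
def HGroup.s : HGroup := PresentedGroup.of HGen.s

/-- The generator `a` of `G`. -/
def GGroup.a : GGroup := PresentedGroup.of GGen.a

/-- The generator `b` of `G`. -/
def GGroup.b : GGroup := PresentedGroup.of GGen.b

/-- The generator `s` of `G`. -/
def GGroup.s : GGroup := PresentedGroup.of GGen.s

/-- The generator `t` of `G`. -/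
def GGroup.t : GGroup := PresentedGroup.of GGen.t

/-! `H` is an HNN-extension of `⟨a, b⟩ ≅ ℤ²`, with `s` conjugating `a⁴` to `a²`. The argument runs
in its Bass–Serre tree, encoded by one function: `len (x⁻¹ * y)`, the number of stable letters, is
the distance between the vertices `x⟨a, b⟩` and `y⟨a, b⟩`. The tree enters mainly through the
four-point inequality `len_four_point`.

Hopficity. Let `f` be onto. Since `f a ^ 2` and `f a ^ 4` are conjugate, `f a` fixes a vertex
(`exists_conj_mem_base`); after a conjugation and a `b`-exponent count, `f a = a ^ k`. Counting
homomorphisms to finite affine groups gives `k = ±1` (`isUnit_of_surjective`). As `f b` centralizes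
`a`, composing with an automorphism makes `f` fix `a` and `b` (`injective_of_map_a`). Now induct on
`len g` for `g = f s` (`injective_of_map_eq_base`). If no edges fold at the base vertex, images of
reduced words do not cancel and `f` is injective. Otherwise a twist makes `g` and `g⁻¹` start along
the same edge. Then either some element of `⟨a², g⟩` conjugates `g` to a shorter element, by a
conjugation that an automorphism of `H` realizes (`len_conj_lt`), or ping-pong keeps `s` out of `⟨a,
b, g⟩` (`s_not_mem_closure`), contradicting surjectivity.

The map `stableEnd` is injective because too little cancels between consecutive images of `s^{±1}`.
So `H` embeds in `G`, where `a ↦ a²` extends to a surjection killing a commutator that is nontrivial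
in `H`. -/

/-! ### Length and tree metric on an HNN-extension. -/

namespace HNNExtension

open NormalWord

variable {G : Type*} [Group G] {A B : Subgroup G} {φ : A ≃* B}

/-- The number of stable letters in a reduced word representing `x`. -/
noncomputable def len (x : HNNExtension G A B φ) : ℕ :=
  (NormalWord.equiv φ (Classical.choice (TransversalPair.nonempty G A B)) x).toList.length

theorem len_prod (w : ReducedWord G A B) : len (w.prod φ) = w.toList.length := by
  obtain ⟨w', h1, h2, -⟩ := ReducedWord.exists_normalWord_prod_eq φ
    (Classical.choice (TransversalPair.nonempty G A B)) w
  have h3 : NormalWord.equiv φ (Classical.choice (TransversalPair.nonempty G A B)) (w.prod φ)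
      = w' := by
    rw [← h1]
    exact (NormalWord.equiv φ _).apply_symm_apply w'
  rw [len, h3, ← List.length_map (f := Prod.fst), h2, List.length_map]

variable (φ) in
/-- The product of a word whose letters `t ^ u * g` are listed from right to left. -/
def revProd : List (ℤˣ × G) → HNNExtension G A B φ
  | [] => 1
  | e :: r => revProd r * t ^ (e.1 : ℤ) * of e.2

theorem revProd_eq (r : List (ℤˣ × G)) :
    revProd φ r = (r.reverse.map (fun x => t ^ (x.1 : ℤ) * of x.2)).prod := by
  induction r with
  | nil => rfl
  | cons e r ih => simp [revProd, ih, mul_assoc]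

variable (A B) in
/-- Reducedness of a word whose letters are listed from right to left. -/
def RevReduced (r : List (ℤˣ × G)) : Prop :=
  r.IsChain fun b a => a.2 ∈ toSubgroup A B a.1 → a.1 = b.1

theorem len_of_mul_revProd (c : G) {r : List (ℤˣ × G)} (hr : RevReduced A B r) :
    len (of c * revProd φ r) = r.length := by
  have h := len_prod (φ := φ) ⟨c, r.reverse, List.isChain_reverse.2 hr⟩
  rw [ReducedWord.prod, ← revProd_eq] at h
  simpa using h

/-- The only place where the product could fail to be reduced is the junction of the two words, and
the second hypothesis forbids a pinch there. -/
theorem len_revProd_mul_inv (k c' : G) {r₂ : List (ℤˣ × G)} (h₂ : RevReduced A B r₂) :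
    ∀ {u : ℤˣ} {g : G} {r : List (ℤˣ × G)}, RevReduced A B ((u, g) :: r) →
      (∀ e ∈ r₂.head?, g * e.2⁻¹ ∈ toSubgroup A B u → u = -e.1) →
      len (of k * revProd φ ((u, g) :: r) * (revProd φ r₂)⁻¹ * of c') = r.length + 1 + r₂.length := by
  induction r₂ with
  | nil =>
    intro u g r h₁ _
    have h := len_of_mul_revProd (φ := φ) k (r := (u, g * c') :: r) (by
      unfold RevReduced at h₁ ⊢
      rw [List.isChain_cons] at h₁ ⊢
      exact h₁)
    simpa [revProd, mul_assoc] using h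
  | cons e r₂ ih =>
    obtain ⟨v, h⟩ := e
    intro u g r h₁ hj
    have hj' := hj (v, h) (by simp)
    have h₂' := (List.isChain_cons.1 h₂)
    -- The first letter of `r₂` is inverted and moved to the left word, where it becomes the new
    -- last letter `t ^ (-v)`.
    have key := ih h₂'.2 (u := -v) (g := 1) (r := (u, g * h⁻¹) :: r) (by
      unfold RevReduced at h₁ ⊢
      rw [List.isChain_cons] at h₁
      rw [List.isChain_cons, List.isChain_cons]
      refine ⟨?_, h₁⟩
      rintro y hy
      simp only [List.head?_cons, Option.mem_def, Option.some.injEq] at hy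
      subst hy
      exact hj') (by
      intro e he hmem
      have := h₂'.1 e he
      rw [one_mul, inv_mem_iff] at hmem
      rw [neg_inj]
      by_contra hne
      have hv : -v = e.1 := by
        rcases Int.units_eq_one_or v with rfl | rfl <;>
          rcases Int.units_eq_one_or e.1 with h' | h' <;> simp_all
      rw [hv] at hmem
      exact hne (this hmem).symm)
    simp only [revProd, List.length_cons, mul_inv_rev, map_one, mul_one, map_mul, map_inv,
      Units.val_neg, zpow_neg] at key ⊢
    rw [← mul_assoc, ← mul_assoc] at key ⊢
    simp only [mul_assoc] at key ⊢
    rw [key]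
    omega

theorem len_of_mul_revProd_inv (c : G) {r : List (ℤˣ × G)} (hr : RevReduced A B r) (c' : G) :
    len (of c * (revProd φ r)⁻¹ * of c') = r.length := by
  cases r with
  | nil =>
    simpa [revProd] using len_of_mul_revProd (φ := φ) (c * c') (r := []) List.isChain_nil
  | cons e r =>
    obtain ⟨v, h⟩ := e
    have h' := List.isChain_cons.1 hr
    have key := len_revProd_mul_inv (φ := φ) (c * h⁻¹) c' h'.2 (u := -v) (g := 1) (r := []) (by
      unfold RevReduced; simp) (by
      intro e he hmem
      have := h'.1 e he
      rw [one_mul, inv_mem_iff] at hmem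
      rw [neg_inj]
      by_contra hne
      have hv : -v = e.1 := by
        rcases Int.units_eq_one_or v with rfl | rfl <;>
          rcases Int.units_eq_one_or e.1 with h' | h' <;> simp_all
      rw [hv] at hmem
      exact hne (this hmem).symm)
    simp only [revProd, List.length_cons, mul_inv_rev, map_one, mul_one, map_mul, map_inv,
      Units.val_neg, zpow_neg, List.length_nil, one_mul] at key ⊢
    simp only [mul_assoc] at key ⊢
    rw [key]
    omega

open Classical in
/-- The distance in the tree of lists ordered by the prefix relation. -/
noncomputable def prefixDist {α : Type*} : List α → List α → ℕ
  | [], l => l.length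
  | l, [] => l.length
  | e :: l, e' :: l' => if e = e' then prefixDist l l' else l.length + l'.length + 2

theorem prefixDist_nil {α : Type*} (l : List α) : prefixDist l [] = l.length := by
  cases l <;> simp [prefixDist]

theorem prefixDist_le {α : Type*} (x y : List α) : prefixDist x y ≤ x.length + y.length := by
  induction x generalizing y with
  | nil => simp [prefixDist]
  | cons e x ih =>
    cases y with
    | nil => simp [prefixDist]
    | cons e' y =>
      have := ih y
      simp only [prefixDist, List.length_cons]
      split_ifs <;> omega

/-- Twice the length of the common prefix of two lists is the sum of their lengths minus
`prefixDist`, and common prefix lengths satisfy the ultrametric inequality. -/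
theorem prefixDist_four_point {α : Type*} (x y z : List α) :
    prefixDist x z + y.length ≤
      max (prefixDist x y + z.length) (x.length + prefixDist y z) := by
  induction y generalizing x z with
  | nil =>
    have := prefixDist_le x z
    rw [prefixDist_nil]
    simp only [List.length_nil]
    omega
  | cons e y ih =>
    cases x with
    | nil => simp [prefixDist]; omega
    | cons e' x =>
      cases z with
      | nil => simp [prefixDist]
      | cons e'' z =>
        have h1 := ih x z
        have h2 := prefixDist_le x z
        simp only [prefixDist, List.length_cons]
        split_ifs with h h' h'' <;> first | omega | (exfalso; simp_all)

variable (φ) in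
/-- The letters of the normal form of `x`, listed from right to left. -/
noncomputable def revLetters (d : TransversalPair G A B) (x : HNNExtension G A B φ) :
    List (ℤˣ × G) :=
  (NormalWord.equiv φ d x).toList.reverse

theorem exists_eq_of_mul_revProd (d : TransversalPair G A B) (x : HNNExtension G A B φ) :
    ∃ c, x = of c * revProd φ (revLetters φ d x) := by
  refine ⟨(NormalWord.equiv φ d x).head, ?_⟩
  have h := (NormalWord.equiv φ d).symm_apply_apply x
  conv_lhs => rw [← h]
  rw [revLetters, revProd_eq, List.reverse_reverse]
  rfl

theorem revReduced_revLetters (d : TransversalPair G A B) (x : HNNExtension G A B φ) :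
    RevReduced A B (revLetters φ d x) := by
  have := (NormalWord.equiv φ d x).chain
  unfold RevReduced
  rw [revLetters, List.isChain_reverse]
  exact this

theorem mem_set_of_mem_revLetters (d : TransversalPair G A B) (x : HNNExtension G A B φ)
    {e : ℤˣ × G} (he : e ∈ revLetters φ d x) : e.2 ∈ d.set e.1 :=
  (NormalWord.equiv φ d x).mem_set _ _ (by simpa [revLetters] using he)

theorem length_revLetters (d : TransversalPair G A B) (x : HNNExtension G A B φ) :
    (revLetters φ d x).length = len x := by
  obtain ⟨c, hc⟩ := exists_eq_of_mul_revProd d x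
  conv_rhs => rw [hc]
  rw [len_of_mul_revProd c (revReduced_revLetters d x)]

/-- Equal letters at the junction cancel. At the first different letters nothing more cancels:
either the signs differ, or the coset representatives do, and the transversal puts them in different
cosets. -/
theorem len_mul_inv_of_revReduced (d : TransversalPair G A B) (c c' : G) (r₁ r₂ : List (ℤˣ × G))
    (h₁ : RevReduced A B r₁) (h₂ : RevReduced A B r₂)
    (m₁ : ∀ e ∈ r₁, e.2 ∈ d.set e.1) (m₂ : ∀ e ∈ r₂, e.2 ∈ d.set e.1) :
    len (of c * revProd φ r₁ * (revProd φ r₂)⁻¹ * of c') = prefixDist r₁ r₂ := by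
  induction r₁ generalizing r₂ with
  | nil => simpa [revProd, prefixDist] using len_of_mul_revProd_inv (φ := φ) c h₂ c'
  | cons e r₁ ih =>
    obtain ⟨u, g⟩ := e
    cases r₂ with
    | nil =>
      rw [prefixDist_nil]
      exact len_revProd_mul_inv (φ := φ) c c' (r₂ := []) h₂ h₁ (by simp)
    | cons e' r₂ =>
      simp only [prefixDist]
      split_ifs with h
      · subst h
        have key := ih r₂ (List.isChain_cons.1 h₁).2 (List.isChain_cons.1 h₂).2
          (fun e he => m₁ e (List.mem_cons_of_mem _ he))
          (fun e he => m₂ e (List.mem_cons_of_mem _ he))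
        rw [← key]
        congr 1
        simp only [revProd]
        group
      · rw [len_revProd_mul_inv (φ := φ) c c' h₂ h₁]
        · simp only [List.length_cons]; omega
        · intro e he hmem
          simp only [List.head?_cons, Option.mem_def, Option.some.injEq] at he
          subst he
          by_contra hne
          have huv : u = e'.1 := by
            rcases Int.units_eq_one_or u with rfl | rfl <;>
              rcases Int.units_eq_one_or e'.1 with h' | h' <;> simp_all
          have hg := m₁ (u, g) (by simp)
          have hg' := m₂ e' (by simp)
          rw [← huv] at hg'
          have := (d.compl u).1 (a₁ := (⟨1, one_mem _⟩, ⟨g, hg⟩))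
            (a₂ := (⟨g * e'.2⁻¹, hmem⟩, ⟨e'.2, hg'⟩)) (by simp)
          simp only [Prod.mk.injEq, Subtype.mk.injEq] at this
          exact h (Prod.ext huv this.2)

theorem len_mul_inv_eq_prefixDist (d : TransversalPair G A B) (x y : HNNExtension G A B φ) :
    len (x * y⁻¹) = prefixDist (revLetters φ d x) (revLetters φ d y) := by
  obtain ⟨c, hc⟩ := exists_eq_of_mul_revProd d x
  obtain ⟨c', hc'⟩ := exists_eq_of_mul_revProd d y
  rw [← len_mul_inv_of_revReduced (φ := φ) d c c'⁻¹ _ _ (revReduced_revLetters d x)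
    (revReduced_revLetters d y) (fun _ => mem_set_of_mem_revLetters d x)
    (fun _ => mem_set_of_mem_revLetters d y)]
  conv_lhs => rw [hc, hc']
  simp only [mul_inv_rev, map_inv, mul_assoc]

/-- The tree inequality for the length function, in the form of an ultrametric inequality for
Gromov products at the identity. -/
theorem len_four_point (x y z : HNNExtension G A B φ) :
    len (x⁻¹ * z) + len y⁻¹ ≤
      max (len (x⁻¹ * y) + len z⁻¹) (len x⁻¹ + len (y⁻¹ * z)) := by
  obtain ⟨d⟩ := TransversalPair.nonempty G A B
  have h := prefixDist_four_point (revLetters φ d x⁻¹) (revLetters φ d y⁻¹) (revLetters φ d z⁻¹)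
  simp only [← len_mul_inv_eq_prefixDist, length_revLetters, inv_inv] at h
  exact h

theorem len_inv (x : HNNExtension G A B φ) : len x⁻¹ = len x := by
  obtain ⟨d⟩ := TransversalPair.nonempty G A B
  obtain ⟨c, hc⟩ := exists_eq_of_mul_revProd d x
  have h := len_of_mul_revProd_inv (φ := φ) 1 (revReduced_revLetters d x) c⁻¹
  rw [length_revLetters] at h
  rw [← h]
  conv_lhs => rw [hc]
  simp

theorem len_of_mul (c : G) (x : HNNExtension G A B φ) : len (of c * x) = len x := by
  obtain ⟨d⟩ := TransversalPair.nonempty G A B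
  obtain ⟨c', hc⟩ := exists_eq_of_mul_revProd d x
  rw [← length_revLetters d x]
  conv_lhs => rw [hc, ← mul_assoc, ← map_mul]
  exact len_of_mul_revProd _ (revReduced_revLetters d x)

theorem len_mul_of (c : G) (x : HNNExtension G A B φ) : len (x * of c) = len x := by
  rw [← len_inv, mul_inv_rev, ← map_inv, len_of_mul, len_inv]

theorem len_eq_zero {x : HNNExtension G A B φ} : len x = 0 ↔ x ∈ (of (φ := φ)).range := by
  obtain ⟨d⟩ := TransversalPair.nonempty G A B
  constructor
  · intro h
    obtain ⟨c, hc⟩ := exists_eq_of_mul_revProd d x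
    rw [← length_revLetters d, List.length_eq_zero_iff] at h
    rw [h] at hc
    exact ⟨c, by simpa [revProd] using hc.symm⟩
  · rintro ⟨c, rfl⟩
    simpa [revProd] using len_of_mul_revProd (φ := φ) c (r := []) List.isChain_nil

theorem len_t_zpow (u : ℤˣ) : len (t ^ (u : ℤ) : HNNExtension G A B φ) = 1 := by
  simpa [revProd] using len_of_mul_revProd (φ := φ) 1 (r := [(u, 1)]) (List.isChain_singleton _)

theorem exists_eq_of_mul_t_mul {x : HNNExtension G A B φ} (hx : len x ≠ 0) :
    ∃ (c : G) (u : ℤˣ) (z : HNNExtension G A B φ),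
      x = of c * t ^ (u : ℤ) * z ∧ len x = len z + 1 := by
  obtain ⟨d⟩ := TransversalPair.nonempty G A B
  obtain ⟨w, rfl⟩ := (NormalWord.equiv φ d).symm.surjective x
  change ∃ (c : G) (u : ℤˣ) (z : HNNExtension G A B φ), w.prod φ = _ ∧ len (w.prod φ) = _
  change len (w.prod φ) ≠ 0 at hx
  cases w using consRecOn with
  | ofGroup g => simp [len_prod] at hx
  | cons g u w h1 h2 =>
    exact ⟨g, u, w.prod φ, by rw [prod_cons, mul_assoc], by rw [len_prod, len_prod]; simp⟩

theorem len_t_of_t {u v : ℤˣ} {c : G} (h : c ∈ toSubgroup A B u → u = v) :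
    len (t ^ (u : ℤ) * of c * t ^ (v : ℤ) : HNNExtension G A B φ) = 2 := by
  simpa [revProd] using len_of_mul_revProd (φ := φ) 1 (r := [(v, 1), (u, c)]) (by
    unfold RevReduced
    simpa using h)

end HNNExtension

/-! ### `H` as an HNN-extension of `ℤ²`, its length function and exponent sums. -/

namespace HGroup

theorem commute_a_b : Commute a b := by
  have h : (b⁻¹ * a * b * a⁻¹ : HGroup) = 1 :=
    PresentedGroup.one_of_mem (rels := HRels) (x := (FreeGroup.of HGen.b)⁻¹ *
      FreeGroup.of HGen.a * FreeGroup.of HGen.b * (FreeGroup.of HGen.a)⁻¹) (by simp [HRels])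
  have h' : b⁻¹ * a * b = a := by rwa [mul_inv_eq_one] at h
  calc a * b = b * (b⁻¹ * a * b) := by group
    _ = b * a := by rw [h']

theorem a_sq_mul_s : a ^ 2 * s = s * a ^ 4 := by
  have h : (s⁻¹ * a ^ 2 * s * (a ^ 4)⁻¹ : HGroup) = 1 :=
    PresentedGroup.one_of_mem (rels := HRels) (x := (FreeGroup.of HGen.s)⁻¹ *
      FreeGroup.of HGen.a ^ 2 * FreeGroup.of HGen.s * (FreeGroup.of HGen.a ^ 4)⁻¹)
      (by simp [HRels])
  have h' : s⁻¹ * a ^ 2 * s = a ^ 4 := by rwa [mul_inv_eq_one] at h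
  calc a ^ 2 * s = s * (s⁻¹ * a ^ 2 * s) := by group
    _ = s * a ^ 4 := by rw [h']

section lift

variable {K : Type*} [Group K]

/-- The homomorphism out of `H` with prescribed values on the generators. -/
def lift (x y z : K) (hxy : Commute x y) (hz : x ^ 2 * z = z * x ^ 4) : HGroup →* K :=
  PresentedGroup.toGroup (f := fun g => HGen.casesOn g x y z) (by
    intro r hr
    rcases hr with rfl | rfl
    · simp only [map_mul, map_inv, FreeGroup.lift_apply_of]
      rw [mul_assoc y⁻¹, hxy.eq]
      group
    · simp only [map_mul, map_inv, map_pow, FreeGroup.lift_apply_of]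
      rw [mul_assoc z⁻¹, hz]
      group)

variable (x y z : K) (hxy : Commute x y) (hz : x ^ 2 * z = z * x ^ 4)

@[simp] theorem lift_a : lift x y z hxy hz a = x := PresentedGroup.toGroup.of _
@[simp] theorem lift_b : lift x y z hxy hz b = y := PresentedGroup.toGroup.of _
@[simp] theorem lift_s : lift x y z hxy hz s = z := PresentedGroup.toGroup.of _

theorem hom_ext {f g : HGroup →* K} (ha : f a = g a) (hb : f b = g b) (hs : f s = g s) :
    f = g :=
  PresentedGroup.ext (by rintro (_ | _ | _) <;> assumption)

end lift

theorem mem_of_generators {S : Subgroup HGroup} (ha : a ∈ S) (hb : b ∈ S) (hs : s ∈ S)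
    (x : HGroup) : x ∈ S :=
  PresentedGroup.generated_by HRels S (by rintro (_ | _ | _) <;> assumption) x

theorem surjective_of_generators {K : Type*} [Group K] {f : K →* HGroup} (ha : a ∈ f.range)
    (hb : b ∈ f.range) (hs : s ∈ f.range) : Function.Surjective f :=
  fun x => mem_of_generators ha hb hs x

/-- The subgroup `⟨a²⟩` of `⟨a, b⟩ ≅ ℤ²`. -/
def sqSubgroup : Subgroup (Multiplicative (ℤ × ℤ)) :=
  Subgroup.zpowers (Multiplicative.ofAdd (2, 0))

theorem mem_sqSubgroup {x : Multiplicative (ℤ × ℤ)} :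
    x ∈ sqSubgroup ↔ 2 ∣ x.toAdd.1 ∧ x.toAdd.2 = 0 := by
  rw [sqSubgroup, Subgroup.mem_zpowers_iff]
  constructor
  · rintro ⟨k, rfl⟩
    simp [← ofAdd_zsmul]
  · rintro ⟨⟨k, hk⟩, h0⟩
    refine ⟨k, ?_⟩
    rw [← ofAdd_zsmul]
    apply Multiplicative.toAdd.injective
    ext
    · simp [hk, mul_comm]
    · simp [h0]

theorem injective_sq :
    Function.Injective (powMonoidHom 2 : Multiplicative (ℤ × ℤ) →* Multiplicative (ℤ × ℤ)) := by
  intro x y h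
  have h' := congrArg Multiplicative.toAdd h
  simp only [powMonoidHom_apply, toAdd_pow] at h'
  apply Multiplicative.toAdd.injective
  have h1 := congrArg Prod.fst h'
  have h2 := congrArg Prod.snd h'
  rw [Prod.smul_fst, Prod.smul_fst, nsmul_eq_mul, nsmul_eq_mul] at h1
  rw [Prod.smul_snd, Prod.smul_snd, nsmul_eq_mul, nsmul_eq_mul] at h2
  push_cast at h1 h2
  ext <;> omega

/-- The subgroup `⟨a⁴⟩` of `⟨a, b⟩ ≅ ℤ²`. -/
def fourthSubgroup : Subgroup (Multiplicative (ℤ × ℤ)) :=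
  sqSubgroup.map (powMonoidHom 2)

theorem mem_fourthSubgroup {x : Multiplicative (ℤ × ℤ)} :
    x ∈ fourthSubgroup ↔ 4 ∣ x.toAdd.1 ∧ x.toAdd.2 = 0 := by
  rw [fourthSubgroup, Subgroup.mem_map]
  constructor
  · rintro ⟨y, hy, rfl⟩
    rw [mem_sqSubgroup] at hy
    rw [powMonoidHom_apply, toAdd_pow, Prod.smul_fst, Prod.smul_snd, nsmul_eq_mul, nsmul_eq_mul]
    push_cast
    omega
  · rintro ⟨⟨k, hk⟩, h0⟩
    refine ⟨Multiplicative.ofAdd (2 * k, 0), mem_sqSubgroup.2 (by simp), ?_⟩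
    apply Multiplicative.toAdd.injective
    ext
    · simp [hk]; ring
    · simp [h0]

/-- The isomorphism `a⁴ ↦ a²` between the associated subgroups. -/
noncomputable def sqrtEquiv : fourthSubgroup ≃* sqSubgroup :=
  (sqSubgroup.equivMapOfInjective (powMonoidHom 2) injective_sq).symm

theorem sqrtEquiv_sq (x : fourthSubgroup) :
    ((sqrtEquiv x : Multiplicative (ℤ × ℤ)) ^ 2 : Multiplicative (ℤ × ℤ)) = x := by
  have h := (sqSubgroup.equivMapOfInjective (powMonoidHom 2) injective_sq).apply_symm_apply x
  exact congrArg Subtype.val h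

/-- `H` as an HNN-extension of `⟨a, b⟩ ≅ ℤ²`. -/
abbrev HNN : Type := HNNExtension (Multiplicative (ℤ × ℤ)) fourthSubgroup sqSubgroup sqrtEquiv

theorem sqrtEquiv_four (k : ℤ) (h) :
    (sqrtEquiv ⟨Multiplicative.ofAdd (4 * k, 0), h⟩ : Multiplicative (ℤ × ℤ)) =
      Multiplicative.ofAdd (2 * k, 0) := by
  apply injective_sq
  rw [powMonoidHom_apply, sqrtEquiv_sq]
  apply Multiplicative.toAdd.injective
  ext
  · simp; ring
  · simp

/-- The inclusion of `⟨a, b⟩ ≅ ℤ²` into `H`. -/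
def ofBase : Multiplicative (ℤ × ℤ) →* HGroup where
  toFun x := a ^ x.toAdd.1 * b ^ x.toAdd.2
  map_one' := by simp
  map_mul' x y := by
    have h : b ^ x.toAdd.2 * a ^ y.toAdd.1 = a ^ y.toAdd.1 * b ^ x.toAdd.2 :=
      (commute_a_b.zpow_zpow _ _).symm.eq
    simp only [toAdd_mul, Prod.fst_add, Prod.snd_add, zpow_add, mul_assoc]
    rw [← mul_assoc (b ^ x.toAdd.2), h, mul_assoc]

theorem ofBase_apply (i j : ℤ) : ofBase (Multiplicative.ofAdd (i, j)) = a ^ i * b ^ j := rfl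

theorem a_sq_zpow_mul_s (k : ℤ) : (a ^ 2) ^ k * s = s * (a ^ 4) ^ k := by
  have h : SemiconjBy s (a ^ 4) (a ^ 2) := a_sq_mul_s.symm
  exact (h.zpow_right k).eq.symm

/-- The map from `H` to its description as an HNN-extension. -/
noncomputable def toHNN : HGroup →* HNN :=
  lift (HNNExtension.of (Multiplicative.ofAdd (1, 0))) (HNNExtension.of (Multiplicative.ofAdd (0, 1)))
    HNNExtension.t ((Commute.all _ _).map _) (by
      have h := HNNExtension.t_mul_of (φ := sqrtEquiv)
        ⟨Multiplicative.ofAdd (4 * 1, 0), mem_fourthSubgroup.2 (by simp)⟩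
      rw [sqrtEquiv_four] at h
      have e (n : ℕ) : (Multiplicative.ofAdd ((1 : ℤ), (0 : ℤ))) ^ n =
          Multiplicative.ofAdd ((n : ℤ), 0) := by
        rw [← ofAdd_nsmul]
        simp
      rw [← map_pow HNNExtension.of, ← map_pow HNNExtension.of, e, e]
      simpa using h.symm)

/-- The inverse of `toHNN`. -/
noncomputable def ofHNN : HNN →* HGroup :=
  HNNExtension.lift ofBase s (by
    rintro ⟨x, hx⟩
    obtain ⟨⟨k, hk⟩, h0⟩ := mem_fourthSubgroup.1 hx
    obtain rfl : x = Multiplicative.ofAdd (4 * k, 0) := by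
      apply Multiplicative.toAdd.injective
      ext
      · simp [hk]
      · simp [h0]
    rw [sqrtEquiv_four, ofBase_apply, ofBase_apply, zpow_zero, mul_one, mul_one]
    rw [zpow_mul, zpow_mul]
    exact (a_sq_zpow_mul_s k).symm)

theorem toHNN_ofBase (x : Multiplicative (ℤ × ℤ)) : toHNN (ofBase x) = HNNExtension.of x := by
  obtain ⟨i, j⟩ := x
  change toHNN (ofBase (Multiplicative.ofAdd (i, j))) = HNNExtension.of (Multiplicative.ofAdd (i, j))
  rw [ofBase_apply, map_mul, map_zpow, map_zpow, toHNN, lift_a, lift_b, ← map_zpow HNNExtension.of,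
    ← map_zpow HNNExtension.of, ← map_mul HNNExtension.of, ← ofAdd_zsmul, ← ofAdd_zsmul, ← ofAdd_add]
  simp

@[simp] theorem toHNN_s : toHNN s = HNNExtension.t := lift_s _ _ _ _ _

theorem ofHNN_toHNN (x : HGroup) : ofHNN (toHNN x) = x := by
  have h : ofHNN.comp toHNN = MonoidHom.id _ := by
    apply hom_ext <;> simp [toHNN, ofHNN, ofBase_apply]
  exact DFunLike.congr_fun h x

theorem toHNN_ofHNN (x : HNN) : toHNN (ofHNN x) = x := by
  have h : toHNN.comp ofHNN = MonoidHom.id _ := by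
    apply HNNExtension.hom_ext
    · refine MonoidHom.ext fun x => ?_
      simp [ofHNN, toHNN_ofBase]
    · simp [ofHNN]
  exact DFunLike.congr_fun h x

/-- The subgroup `⟨a, b⟩` of `H`. -/
def base : Subgroup HGroup := ofBase.range

theorem mem_base {x : HGroup} : x ∈ base ↔ ∃ i j : ℤ, x = a ^ i * b ^ j := by
  constructor
  · rintro ⟨y, rfl⟩
    exact ⟨_, _, rfl⟩
  · rintro ⟨i, j, rfl⟩
    exact ⟨Multiplicative.ofAdd (i, j), rfl⟩

theorem a_zpow_mem_base (i : ℤ) : a ^ i ∈ base := mem_base.2 ⟨i, 0, by simp⟩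

theorem a_mem_base : a ∈ base := by simpa using a_zpow_mem_base 1

theorem b_mem_base : b ∈ base := mem_base.2 ⟨0, 1, by simp⟩

theorem mul_comm_of_mem_base {x y : HGroup} (hx : x ∈ base) (hy : y ∈ base) : x * y = y * x := by
  obtain ⟨x, rfl⟩ := hx
  obtain ⟨y, rfl⟩ := hy
  rw [← map_mul, mul_comm, map_mul]

theorem ofBase_injective : Function.Injective ofBase := by
  intro x y h
  apply HNNExtension.of_injective (φ := sqrtEquiv)
  rw [← toHNN_ofBase, h, toHNN_ofBase]

theorem base_ext {i j i' j' : ℤ} (h : a ^ i * b ^ j = a ^ i' * b ^ j') : i = i' ∧ j = j' := by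
  have := ofBase_injective (a₁ := Multiplicative.ofAdd (i, j))
    (a₂ := Multiplicative.ofAdd (i', j')) h
  simpa using this

theorem a_zpow_injective : Function.Injective fun i : ℤ => a ^ i := by
  intro i j h
  exact (base_ext (j := 0) (j' := 0) (by simpa using h)).1

/-- The number of letters `s` in a reduced word representing `x`. -/
noncomputable def len (x : HGroup) : ℕ := HNNExtension.len (toHNN x)

theorem toHNN_mem_range {x : HGroup} : toHNN x ∈ (HNNExtension.of (φ := sqrtEquiv)).range ↔
    x ∈ base := by
  constructor
  · rintro ⟨c, hc⟩
    refine ⟨c, ?_⟩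
    rw [← ofHNN_toHNN x, ← hc, ← toHNN_ofBase, ofHNN_toHNN]
  · rintro ⟨c, rfl⟩
    exact ⟨c, (toHNN_ofBase c).symm⟩

theorem len_eq_zero {x : HGroup} : len x = 0 ↔ x ∈ base := by
  rw [len, HNNExtension.len_eq_zero, toHNN_mem_range]

@[simp] theorem len_one : len 1 = 0 := len_eq_zero.2 (one_mem _)

@[simp] theorem len_inv (x : HGroup) : len x⁻¹ = len x := by
  rw [len, map_inv, HNNExtension.len_inv, len]

theorem len_mul_left {c : HGroup} (hc : c ∈ base) (x : HGroup) : len (c * x) = len x := by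
  obtain ⟨c, rfl⟩ := hc
  rw [len, map_mul, toHNN_ofBase, HNNExtension.len_of_mul, len]

theorem len_mul_right {c : HGroup} (hc : c ∈ base) (x : HGroup) : len (x * c) = len x := by
  obtain ⟨c, rfl⟩ := hc
  rw [len, map_mul, toHNN_ofBase, HNNExtension.len_mul_of, len]

/-- The four-point condition for a tree, obtained from the version based at the identity by
translating `w` to the base vertex. -/
theorem len_four_point (x y z w : HGroup) :
    len (x⁻¹ * y) + len (z⁻¹ * w) ≤
      max (len (x⁻¹ * z) + len (y⁻¹ * w)) (len (x⁻¹ * w) + len (y⁻¹ * z)) := by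
  have h := HNNExtension.len_four_point (toHNN (w⁻¹ * x)) (toHNN (w⁻¹ * z)) (toHNN (w⁻¹ * y))
  simp only [← map_inv, ← map_mul] at h
  have e (p q : HGroup) : (w⁻¹ * p)⁻¹ * (w⁻¹ * q) = p⁻¹ * q := by group
  have h1 : len ((w⁻¹ * x)⁻¹ * (w⁻¹ * y)) + len (w⁻¹ * z)⁻¹ ≤
    max (len ((w⁻¹ * x)⁻¹ * (w⁻¹ * z)) + len (w⁻¹ * y)⁻¹)
      (len (w⁻¹ * x)⁻¹ + len ((w⁻¹ * z)⁻¹ * (w⁻¹ * y))) := h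
  rw [e, e, e, mul_inv_rev, mul_inv_rev, mul_inv_rev, inv_inv] at h1
  have h2 : len (z⁻¹ * y) = len (y⁻¹ * z) := by rw [← len_inv]; simp
  rw [h2] at h1
  exact h1

theorem len_mul_le (x y : HGroup) : len (x * y) ≤ len x + len y := by
  have h := len_four_point x⁻¹ y 1 1
  simp only [inv_inv, inv_one, mul_one, len_one, len_inv] at h
  omega

theorem len_s_zpow (u : ℤˣ) : len (s ^ (u : ℤ)) = 1 := by
  rw [len, map_zpow, toHNN_s, HNNExtension.len_t_zpow]

theorem exists_eq_mul_s_mul {x : HGroup} (hx : x ∉ base) :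
    ∃ c ∈ base, ∃ (u : ℤˣ) (z : HGroup), x = c * s ^ (u : ℤ) * z ∧ len x = len z + 1 := by
  rw [← len_eq_zero] at hx
  obtain ⟨c, u, z, h, h'⟩ := HNNExtension.exists_eq_of_mul_t_mul hx
  refine ⟨ofBase c, ⟨c, rfl⟩, u, ofHNN z, ?_, ?_⟩
  · rw [← ofHNN_toHNN x, h, map_mul, map_mul, map_zpow, ← toHNN_ofBase, ofHNN_toHNN,
      ← toHNN_s, ofHNN_toHNN]
  · rw [len, h', len, toHNN_ofHNN]

/-- The `s`-exponent sum. -/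
def sExp : HGroup →* Multiplicative ℤ :=
  lift 1 1 (Multiplicative.ofAdd 1) (Commute.all _ _) (by simp)

/-- The `b`-exponent sum. -/
def bExp : HGroup →* Multiplicative ℤ :=
  lift 1 (Multiplicative.ofAdd 1) 1 (Commute.all _ _) (by simp)

@[simp] theorem sExp_s : sExp s = Multiplicative.ofAdd 1 := lift_s _ _ _ _ _

theorem sExp_of_mem_base {c : HGroup} (hc : c ∈ base) : sExp c = 1 := by
  obtain ⟨i, j, rfl⟩ := mem_base.1 hc
  simp [sExp]

/-- Each letter `s ^ (±1)` of a reduced word contributes `±1` to the exponent sum. -/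
theorem sExp_bounds (x : HGroup) : |(sExp x).toAdd| ≤ len x ∧ 2 ∣ (sExp x).toAdd - len x := by
  induction h : len x generalizing x with
  | zero => simp [sExp_of_mem_base (len_eq_zero.1 h)]
  | succ n ih =>
    obtain ⟨c, hc, u, z, rfl, h'⟩ := exists_eq_mul_s_mul (x := x) (by rw [← len_eq_zero]; omega)
    obtain ⟨h1, h2⟩ := ih z (by omega)
    rw [map_mul sExp, map_mul sExp, sExp_of_mem_base hc, one_mul, map_zpow, sExp_s]
    rcases Int.units_eq_one_or u with rfl | rfl
    · simp; rw [abs_le] at *; omega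
    · simp; rw [abs_le] at *; omega

/-- The subgroup `⟨a⁴⟩` for `u = 1` and `⟨a²⟩` for `u = -1`; its elements `c` are those elements of
`⟨a, b⟩` for which `s ^ u * c * s ^ (-u)` lies in `⟨a, b⟩`. -/
def edge (u : ℤˣ) : ℤ := if u = 1 then 4 else 2

theorem len_s_mul_s {u v : ℤˣ} {i j : ℤ} (h : edge u ∣ i → j = 0 → u = v) :
    len (s ^ (u : ℤ) * (a ^ i * b ^ j) * s ^ (v : ℤ)) = 2 := by
  rw [len, map_mul, map_mul, map_zpow, map_zpow, ← ofBase_apply, toHNN_ofBase, toHNN_s]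
  apply HNNExtension.len_t_of_t
  rcases Int.units_eq_one_or u with rfl | rfl
  · simpa [edge, mem_fourthSubgroup] using h
  · simpa [edge, mem_sqSubgroup] using h

theorem s_mul_a_four_mul (k : ℤ) : s * a ^ (4 * k) = a ^ (2 * k) * s := by
  have := a_sq_zpow_mul_s k
  rw [zpow_mul, zpow_mul]
  exact this.symm

end HGroup

/-! ### Initial edges of geodesics, edge stabilizers, and a local injectivity criterion. -/

namespace HGroup

/-- The geodesics from the base vertex of the Bass–Serre tree to its translates under `x` and `y`
have the same first edge. -/
def SameStart (x y : HGroup) : Prop := len (x⁻¹ * y) < len x + len y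

theorem len_inv_mul_comm (x y : HGroup) : len (x⁻¹ * y) = len (y⁻¹ * x) := by
  rw [← len_inv]; simp

theorem SameStart.symm {x y : HGroup} (h : SameStart x y) : SameStart y x := by
  unfold SameStart at *
  rw [len_inv_mul_comm]
  omega

/-- `SameStart` says that the Gromov product at the base vertex is positive; the four-point
inequality makes this transitive. -/
theorem SameStart.trans {x y z : HGroup} (h : SameStart x y) (h' : SameStart y z) :
    SameStart x z := by
  unfold SameStart at *
  have := len_four_point x z 1 y
  simp only [inv_one, one_mul, mul_one, len_inv] at this
  rw [len_inv_mul_comm z y] at this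
  omega

theorem sameStart_of_mem_base {x y : HGroup} (hx : x ∉ base) (h : x⁻¹ * y ∈ base) :
    SameStart x y := by
  rw [← len_eq_zero] at hx h
  unfold SameStart
  omega

theorem sameStart_refl {x : HGroup} (hx : x ∉ base) : SameStart x x :=
  sameStart_of_mem_base hx (by simp [one_mem])

theorem sameStart_mul_right {x c : HGroup} (hx : x ∉ base) (hc : c ∈ base) :
    SameStart x (x * c) :=
  sameStart_of_mem_base hx (by simpa using hc)

theorem sameStart_mul_left_iff {x y c : HGroup} (hc : c ∈ base) :
    SameStart (c * x) (c * y) ↔ SameStart x y := by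
  unfold SameStart
  rw [len_mul_left hc, len_mul_left hc, show (c * x)⁻¹ * (c * y) = x⁻¹ * y by group]

theorem SameStart.not_mem_base_left {x y : HGroup} (h : SameStart x y) : x ∉ base := by
  intro hx
  unfold SameStart at h
  rw [len_mul_left (inv_mem hx), len_eq_zero.2 hx] at h
  omega

theorem SameStart.not_mem_base_right {x y : HGroup} (h : SameStart x y) : y ∉ base :=
  h.symm.not_mem_base_left

theorem len_inv_mul_of_not_sameStart {x y : HGroup} (h : ¬ SameStart x y) :
    len (x⁻¹ * y) = len x + len y := by
  unfold SameStart at h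
  have := len_mul_le x⁻¹ y
  rw [len_inv] at this
  omega

theorem len_mul_of_not_sameStart {x y : HGroup} (h : ¬ SameStart x⁻¹ y) :
    len (x * y) = len x + len y := by
  simpa using len_inv_mul_of_not_sameStart h

theorem sameStart_mul_of_not_sameStart {x y : HGroup} (hx : x ∉ base) (h : ¬ SameStart x⁻¹ y) :
    SameStart x (x * y) := by
  have := len_mul_of_not_sameStart h
  rw [← len_eq_zero] at hx
  unfold SameStart
  rw [inv_mul_cancel_left]
  omega

theorem len_s : len s = 1 := by simpa using len_s_zpow 1

theorem s_zpow_not_mem_base (u : ℤˣ) : s ^ (u : ℤ) ∉ base := by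
  rw [← len_eq_zero, len_s_zpow]
  omega

theorem exists_sameStart_mul_s {x : HGroup} (hx : x ∉ base) :
    ∃ c ∈ base, ∃ u : ℤˣ, SameStart x (c * s ^ (u : ℤ)) := by
  obtain ⟨c, hc, u, z, rfl, h⟩ := exists_eq_mul_s_mul hx
  refine ⟨c, hc, u, ?_⟩
  unfold SameStart
  rw [h, len_mul_left hc, len_s_zpow, show (c * s ^ (u : ℤ) * z)⁻¹ * (c * s ^ (u : ℤ)) = z⁻¹ by group,
    len_inv]
  omega

/-- The action preserves the orientation of edges: `s ^ (-u) * c * s ^ (-u)` never has a pinch. -/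
theorem not_sameStart_s_s_inv {c : HGroup} (hc : c ∈ base) (u : ℤˣ) :
    ¬ SameStart (s ^ (u : ℤ)) (c * s ^ (-u : ℤ)) := by
  obtain ⟨i, j, rfl⟩ := mem_base.1 hc
  unfold SameStart
  have h := len_s_mul_s (u := -u) (v := -u) (i := i) (j := j) (fun _ _ => rfl)
  have h' := len_s_zpow (-u)
  rw [Units.val_neg] at h h'
  rw [len_s_zpow, len_mul_left hc, h', ← zpow_neg, ← mul_assoc, h]
  omega

theorem exists_zpow_of_sameStart_mul_s {c : HGroup} (hc : c ∈ base) {u : ℤˣ}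
    (h : SameStart (s ^ (u : ℤ)) (c * s ^ (u : ℤ))) : ∃ k : ℤ, c = a ^ (edge (-u) * k) := by
  obtain ⟨i, j, rfl⟩ := mem_base.1 hc
  by_cases hij : edge (-u) ∣ i ∧ j = 0
  · obtain ⟨⟨k, rfl⟩, rfl⟩ := hij
    exact ⟨k, by simp⟩
  · have h' := len_s_mul_s (u := -u) (v := u) (i := i) (j := j) (fun h1 h2 => absurd ⟨h1, h2⟩ hij)
    rw [Units.val_neg] at h'
    unfold SameStart at h
    rw [len_s_zpow, len_mul_left hc, len_s_zpow, ← zpow_neg, ← mul_assoc, h'] at h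
    omega

/-- Here `c` fixes the first edge towards `x`. As `⟨a, b⟩` is abelian, the stabilizer of that edge
does not depend on `c₀`. -/
theorem exists_zpow_of_sameStart_mul {x c c₀ : HGroup} {u : ℤˣ} (hc : c ∈ base) (hc₀ : c₀ ∈ base)
    (hx : SameStart x (c₀ * s ^ (u : ℤ))) (h : SameStart x (c * x)) :
    ∃ k : ℤ, c = a ^ (edge (-u) * k) := by
  apply exists_zpow_of_sameStart_mul_s hc
  rw [← sameStart_mul_left_iff hc₀, ← mul_assoc, mul_comm_of_mem_base hc₀ hc, mul_assoc]
  exact (hx.symm.trans h).trans ((sameStart_mul_left_iff hc).2 hx)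

theorem edge_conj (u : ℤˣ) (k : ℤ) :
    s ^ (u : ℤ) * a ^ (edge u * k) = a ^ (edge (-u) * k) * s ^ (u : ℤ) := by
  rcases Int.units_eq_one_or u with rfl | rfl
  · simpa [edge] using s_mul_a_four_mul k
  · simp only [edge, neg_neg, Units.val_neg, Units.val_one, zpow_neg, zpow_one, if_true]
    rw [if_neg (by decide), inv_mul_eq_iff_eq_mul, ← mul_assoc, s_mul_a_four_mul, mul_assoc]
    simp

/-- Local control implies global control: if each junction loses at most `2 * δ`, less than one
image of `s`, cancellations at successive junctions do not interact. -/
theorem len_map_of_junction (f : HGroup →* HGroup) (hbase : ∀ c ∈ base, f c ∈ base)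
    (δ : ℕ) (hδ : 2 * δ < len (f s))
    (hj : ∀ c ∈ base, ∀ u v : ℤˣ, s ^ (u : ℤ) * c * s ^ (v : ℤ) ∉ base →
      2 * len (f s) ≤ len (f s ^ (u : ℤ) * f c * f s ^ (v : ℤ)) + 2 * δ)
    (n : ℕ) : ∀ (c : HGroup) (u : ℤˣ) (z : HGroup), len z = n → c ∈ base →
      len (c * s ^ (u : ℤ) * z) = len z + 1 →
      len (f z) + len (f s) ≤ len (f (c * s ^ (u : ℤ) * z)) + 2 * δ := by
  have hgu (u : ℤˣ) : len (f s ^ (u : ℤ)) = len (f s) := by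
    rcases Int.units_eq_one_or u with rfl | rfl <;> simp
  induction n with
  | zero =>
    intro c u z hz hc _
    rw [len_eq_zero] at hz
    rw [map_mul, map_mul, map_zpow, len_mul_right (hbase z hz), len_mul_left (hbase c hc), hgu,
      len_eq_zero.2 (hbase z hz)]
    omega
  | succ n ih =>
    intro c u z hz hc hl
    obtain ⟨c', hc', v, z', rfl, hz'⟩ := exists_eq_mul_s_mul (x := z) (by rw [← len_eq_zero]; omega)
    have h1 := ih c' v z' (by omega) hc' hz'
    have h2 := hj c' hc' u v (by
      intro hmem
      rw [show c * s ^ (u : ℤ) * (c' * s ^ (v : ℤ) * z') =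
        c * ((s ^ (u : ℤ) * c' * s ^ (v : ℤ)) * z') by group, len_mul_left hc,
        len_mul_left hmem] at hl
      omega)
    -- Of the two alternatives in the maximum, the first would give `2 * len (f s) ≤ 4 * δ`, which
    -- `hδ` excludes.
    have h3 := len_four_point (f s ^ (-u : ℤ)) (f (c' * s ^ (v : ℤ))) 1
      (f (c' * s ^ (v : ℤ) * z'))
    have e1 : (f s ^ (-u : ℤ))⁻¹ * f (c' * s ^ (v : ℤ)) =
        f s ^ (u : ℤ) * f c' * f s ^ (v : ℤ) := by
      rw [map_mul, map_zpow, zpow_neg, inv_inv, mul_assoc]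
    have e2 : (f (c' * s ^ (v : ℤ)))⁻¹ * f (c' * s ^ (v : ℤ) * z') = f z' := by
      rw [map_mul f _ z']; group
    have e3 : (f s ^ (-u : ℤ))⁻¹ * f (c' * s ^ (v : ℤ) * z') =
        f s ^ (u : ℤ) * f (c' * s ^ (v : ℤ) * z') := by
      rw [zpow_neg, inv_inv]
    have e4 : len (f (c' * s ^ (v : ℤ))) = len (f s) := by
      rw [map_mul, len_mul_left (hbase _ hc'), map_zpow, hgu]
    have e5 : len (f s ^ (-u : ℤ)) = len (f s) := by
      rw [zpow_neg, len_inv, hgu]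
    rw [e1, e2, e3] at h3
    simp only [inv_one, one_mul, mul_one, len_inv] at h3
    rw [e4, e5] at h3
    rw [map_mul f _ (c' * s ^ (v : ℤ) * z'), map_mul f c, mul_assoc (f c), len_mul_left (hbase c hc),
      map_zpow]
    omega

/-- A local criterion for injectivity of an endomorphism of `H`: cancellation in images of reduced
words affects less than half of each of the images of `s`. -/
theorem injective_of_junction (f : HGroup →* HGroup) (hbase : ∀ c ∈ base, f c ∈ base)
    (hinj : ∀ c ∈ base, f c = 1 → c = 1) (δ : ℕ) (hδ : 2 * δ < len (f s))
    (hj : ∀ c ∈ base, ∀ u v : ℤˣ, s ^ (u : ℤ) * c * s ^ (v : ℤ) ∉ base →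
      2 * len (f s) ≤ len (f s ^ (u : ℤ) * f c * f s ^ (v : ℤ)) + 2 * δ) :
    Function.Injective f := by
  rw [injective_iff_map_eq_one]
  intro x hx
  by_contra hne
  obtain ⟨c, hc, u, z, rfl, h⟩ := exists_eq_mul_s_mul (fun h => hne (hinj x h hx))
  have h1 := len_map_of_junction f hbase δ hδ hj _ c u z rfl hc h
  rw [hx, len_one] at h1
  omega

end HGroup

/-! ### Elements `g` with `a² g = g a⁴`: attracting end, ping-pong, shortening. -/

namespace HGroup

theorem a_sq_eq_zpow : a ^ 2 = a ^ (2 : ℤ) := (zpow_natCast a 2).symm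

theorem a_sq_mem_base : a ^ 2 ∈ base := by
  rw [a_sq_eq_zpow]
  exact a_zpow_mem_base 2

theorem a_sq_zpow_mem_base (k : ℤ) : (a ^ 2) ^ k ∈ base := zpow_mem a_sq_mem_base k

section axis

variable {g : HGroup}

theorem a_sq_zpow_mul_pow (hg : a ^ 2 * g = g * a ^ 4) (m : ℤ) (N : ℕ) :
    (a ^ 2) ^ m * g ^ N = g ^ N * (a ^ 2) ^ (2 ^ N * m) := by
  induction N generalizing m with
  | zero => simp
  | succ N ih =>
    have h : SemiconjBy g ((a ^ 2) ^ 2) (a ^ 2) := by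
      rw [← pow_mul]
      exact hg.symm
    have h1 : (a ^ 2) ^ m * g = g * (a ^ 2) ^ (2 * m) := by
      have := (h.zpow_right m).eq.symm
      rw [this, ← zpow_natCast (a ^ 2) 2, ← zpow_mul]
      rfl
    rw [pow_succ' g, ← mul_assoc, h1, mul_assoc, ih, ← mul_assoc]
    congr 2
    ring

variable (hσ : sExp g ≠ 1)
include hσ

/-- A nonzero `s`-exponent sum makes `g` hyperbolic. -/
theorem le_len_pow (N : ℕ) : N ≤ len (g ^ N) := by
  have h := (sExp_bounds (g ^ N)).1
  rw [map_pow, toAdd_pow, nsmul_eq_mul, abs_mul, Nat.abs_cast] at h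
  have h1 : 1 ≤ |(sExp g).toAdd| := Int.one_le_abs (by simpa using hσ)
  have h2 : (N : ℤ) * 1 ≤ N * |(sExp g).toAdd| := by gcongr
  omega

theorem pow_not_mem_base {N : ℕ} (hN : N ≠ 0) : g ^ N ∉ base := by
  have := le_len_pow hσ N
  rw [← len_eq_zero]
  omega

theorem len_ne_zero_of_sExp : len g ≠ 0 := by
  have := le_len_pow hσ 1
  rw [pow_one] at this
  omega

/-- Consecutive powers are at distance `len g`, too close for their geodesics to part at the base
vertex once both are at distance at least `len g`. So `g ^ len g` represents the direction of the
attracting end of `g`. -/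
theorem sameStart_pow {N : ℕ} (hN : len g ≤ N) : SameStart (g ^ len g) (g ^ N) := by
  induction N, hN using Nat.le_induction with
  | base => exact sameStart_refl (pow_not_mem_base hσ (len_ne_zero_of_sExp hσ))
  | succ N hN ih =>
    apply ih.trans
    have h1 := le_len_pow hσ N
    have h2 := le_len_pow hσ (N + 1)
    unfold SameStart
    rw [show (g ^ N)⁻¹ * g ^ (N + 1) = g by rw [pow_succ]; group]
    omega

theorem exists_sameStart_s (hg : a ^ 2 * g = g * a ^ 4) :
    ∃ c₀ ∈ base, SameStart (g ^ len g) (c₀ * s) := by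
  have hne := pow_not_mem_base hσ (len_ne_zero_of_sExp hσ)
  obtain ⟨c₀, hc₀, u, h⟩ := exists_sameStart_mul_s hne
  rcases Int.units_eq_one_or u with rfl | rfl
  · exact ⟨c₀, hc₀, by simpa using h⟩
  · exfalso
    -- `a²` fixes the vertex of `g ^ len g`, hence the first edge towards it; for `u = -1` that edge
    -- has stabilizer `⟨a⁴⟩`.
    have h1 := a_sq_zpow_mul_pow hg 1 (len g)
    rw [zpow_one] at h1
    obtain ⟨k, hk⟩ := exists_zpow_of_sameStart_mul a_sq_mem_base hc₀ h
      (by rw [h1]; exact sameStart_mul_right hne (a_sq_zpow_mem_base _))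
    rw [a_sq_eq_zpow] at hk
    have := a_zpow_injective hk
    simp only [edge, neg_neg, if_true] at this
    omega

theorem exists_a_sq_zpow_of_sameStart (hg : a ^ 2 * g = g * a ^ 4) {c : HGroup} (hc : c ∈ base)
    (h : SameStart (g ^ len g) (c * g ^ len g)) : ∃ k : ℤ, c = (a ^ 2) ^ k := by
  obtain ⟨c₀, hc₀, h₀⟩ := exists_sameStart_s hσ hg
  obtain ⟨k, hk⟩ := exists_zpow_of_sameStart_mul (u := 1) hc hc₀ (by simpa using h₀) h
  refine ⟨k, ?_⟩
  rw [hk, a_sq_eq_zpow, ← zpow_mul]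
  congr 1

/-- The relation is that of the Baumslag–Solitar group `BS(1, 2)`: powers of `a²` can be moved right
past `g` and left past `g⁻¹`. -/
theorem exists_form_of_mem_closure (hg : a ^ 2 * g = g * a ^ 4) {w : HGroup}
    (hw : w ∈ Subgroup.closure {a ^ 2, g}) :
    ∃ (i j : ℕ) (m : ℤ), w = g ^ i * (a ^ 2) ^ m * (g ^ j)⁻¹ := by
  induction hw using Subgroup.closure_induction_left with
  | one => exact ⟨0, 0, 0, by simp⟩
  | mul_left x hx y _ ih =>
    obtain ⟨i, j, m, rfl⟩ := ih
    rcases hx with rfl | rfl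
    · refine ⟨i, j, 2 ^ i * 1 + m, ?_⟩
      have := a_sq_zpow_mul_pow hg 1 i
      rw [zpow_one] at this
      rw [zpow_add, ← mul_assoc, ← mul_assoc, ← mul_assoc, this]
    · exact ⟨i + 1, j, m, by rw [pow_succ']; group⟩
  | inv_mul_cancel x hx y _ ih =>
    obtain ⟨i, j, m, rfl⟩ := ih
    rcases hx with rfl | rfl
    · refine ⟨i, j, 2 ^ i * (-1) + m, ?_⟩
      have := a_sq_zpow_mul_pow hg (-1) i
      rw [zpow_neg_one] at this
      rw [zpow_add, ← mul_assoc, ← mul_assoc, ← mul_assoc, this]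
    · cases i with
      | zero =>
        refine ⟨0, j + 1, 2 * m, ?_⟩
        have := a_sq_zpow_mul_pow hg m 1
        rw [pow_one, pow_one] at this
        rw [pow_succ x j, pow_zero, one_mul, one_mul, mul_inv_rev, ← mul_assoc, ← mul_assoc]
        congr 1
        rw [inv_mul_eq_iff_eq_mul, ← mul_assoc, ← this, mul_assoc, mul_inv_cancel, mul_one]
      | succ i => exact ⟨i, j, m, by rw [pow_succ']; group⟩

end axis

/-- Alternating products `w₁ c₁ w₂ c₂ ⋯ wₖ` with `wᵢ ∈ W \ ⟨a, b⟩` and `cᵢ ∈ ⟨a, b⟩ \ ⟨a²⟩`. -/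
inductive IsAlternating (W : Subgroup HGroup) : HGroup → Prop
  | of {w : HGroup} : w ∈ W → w ∉ base → IsAlternating W w
  | mul {w c x : HGroup} : w ∈ W → w ∉ base → c ∈ base → (∀ k : ℤ, c ≠ (a ^ 2) ^ k) →
      IsAlternating W x → IsAlternating W (w * c * x)

theorem IsAlternating.left_mul {W : Subgroup HGroup} {v x : HGroup} (hv : v ∈ W)
    (hx : IsAlternating W x) :
    IsAlternating W (v * x) ∨ v * x ∈ base ∨ ∃ c ∈ base, ∃ y, IsAlternating W y ∧ v * x = c * y := by
  cases hx with
  | of hw hwb =>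
    by_cases h : v * x ∈ base
    · exact Or.inr (Or.inl h)
    · exact Or.inl (.of (mul_mem hv hw) h)
  | @mul w c y hw hwb hc hck hy =>
    by_cases h : v * w ∈ base
    · exact Or.inr (Or.inr ⟨v * w * c, mul_mem h hc, y, hy, by group⟩)
    · exact Or.inl (by
        rw [← mul_assoc, ← mul_assoc]
        exact .mul (mul_mem hv hw) h hc hck hy)

theorem exists_isAlternating {g : HGroup} {x : HGroup}
    (hx : x ∈ Subgroup.closure {a, b, g}) :
    x ∈ base ∨ ∃ c ∈ base, ∃ d ∈ base, ∃ y,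
      IsAlternating (Subgroup.closure {a ^ 2, g}) y ∧ x = c * y * d := by
  set W := Subgroup.closure {a ^ 2, g} with hW
  have ha : a ^ 2 ∈ W := Subgroup.subset_closure (by simp)
  have hg : g ∈ W := Subgroup.subset_closure (by simp)
  have base_mul (v : HGroup) (hv : v ∈ base) (x : HGroup)
      (hx : x ∈ base ∨ ∃ c ∈ base, ∃ d ∈ base, ∃ y, IsAlternating W y ∧ x = c * y * d) :
      v * x ∈ base ∨ ∃ c ∈ base, ∃ d ∈ base, ∃ y, IsAlternating W y ∧ v * x = c * y * d := by
    rcases hx with hx | ⟨c, hc, d, hd, y, hy, rfl⟩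
    · exact Or.inl (mul_mem hv hx)
    · exact Or.inr ⟨v * c, mul_mem hv hc, d, hd, y, hy, by group⟩
  have W_mul (v : HGroup) (hv : v ∈ W) (x : HGroup)
      (hx : x ∈ base ∨ ∃ c ∈ base, ∃ d ∈ base, ∃ y, IsAlternating W y ∧ x = c * y * d) :
      v * x ∈ base ∨ ∃ c ∈ base, ∃ d ∈ base, ∃ y, IsAlternating W y ∧ v * x = c * y * d := by
    by_cases hvb : v ∈ base
    · exact base_mul v hvb x hx
    rcases hx with hx | ⟨c, hc, d, hd, y, hy, rfl⟩
    · exact Or.inr ⟨1, one_mem _, x, hx, v, .of hv hvb, by group⟩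
    by_cases hk : ∃ k : ℤ, c = (a ^ 2) ^ k
    · obtain ⟨k, rfl⟩ := hk
      rcases hy.left_mul (mul_mem hv (zpow_mem ha k)) with h | h | ⟨c', hc', y', hy', h⟩
      · exact Or.inr ⟨1, one_mem _, d, hd, _, h, by group⟩
      · exact Or.inl (by
          rw [← mul_assoc, ← mul_assoc]
          exact mul_mem h hd)
      · refine Or.inr ⟨c', hc', d, hd, y', hy', ?_⟩
        rw [← h]
        group
    · push Not at hk
      exact Or.inr ⟨1, one_mem _, d, hd, v * c * y, .mul hv hvb hc hk hy, by group⟩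
  induction hx using Subgroup.closure_induction_left with
  | one => exact Or.inl (one_mem _)
  | mul_left v hv x _ ih =>
    rcases hv with rfl | rfl | rfl
    · exact base_mul _ a_mem_base _ ih
    · exact base_mul _ b_mem_base _ ih
    · exact W_mul _ hg _ ih
  | inv_mul_cancel v hv x _ ih =>
    rcases hv with rfl | rfl | rfl
    · exact base_mul _ (inv_mem a_mem_base) _ ih
    · exact base_mul _ (inv_mem b_mem_base) _ ih
    · exact W_mul _ (inv_mem hg) _ ih

section

variable {g : HGroup} (hσ : sExp g ≠ 1) (hg : a ^ 2 * g = g * a ^ 4)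
include hσ hg

/-- Ping-pong: elements of `W` outside `⟨a, b⟩` and their inverses all start towards the attracting
end, and every `c` outside `⟨a²⟩` moves this direction, so nothing cancels across `c`. -/
theorem IsAlternating.sameStart
    (hW : ∀ w ∈ Subgroup.closure {a ^ 2, g}, w ∉ base → SameStart w (g ^ len g)) {x : HGroup}
    (hx : IsAlternating (Subgroup.closure {a ^ 2, g}) x) :
    SameStart x (g ^ len g) ∧ SameStart x⁻¹ (g ^ len g) := by
  induction hx with
  | of hw hwb => exact ⟨hW _ hw hwb, hW _ (inv_mem hw) (by rwa [inv_mem_iff])⟩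
  | @mul w c x hw hwb hc hck _ ih =>
    have h1 := hW _ hw hwb
    have h2 := hW _ (inv_mem hw) (by rwa [inv_mem_iff])
    have key : ¬ SameStart (g ^ len g) (c * g ^ len g) := fun h => by
      obtain ⟨k, hk⟩ := exists_a_sq_zpow_of_sameStart hσ hg hc h
      exact hck k hk
    constructor
    · refine SameStart.trans (SameStart.symm ?_) h1
      rw [mul_assoc]
      apply sameStart_mul_of_not_sameStart hwb
      intro h
      exact key ((h2.symm.trans h).trans ((sameStart_mul_left_iff hc).2 ih.1))
    · refine SameStart.trans (SameStart.symm ?_) ih.2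
      rw [mul_inv_rev]
      apply sameStart_mul_of_not_sameStart ih.2.not_mem_base_left
      rw [inv_inv, mul_inv_rev]
      intro h
      have h3 := (ih.1.symm.trans h).trans ((sameStart_mul_left_iff (inv_mem hc)).2 h2)
      rw [← sameStart_mul_left_iff hc, mul_inv_cancel_left] at h3
      exact key h3.symm

/-- If `s = c * y * d` with `y` alternating, `y⁻¹` would start both along a translate of the edge of
`s⁻¹` and along one of the edge of `s`, of opposite orientation. -/
theorem s_not_mem_closure
    (hW : ∀ w ∈ Subgroup.closure {a ^ 2, g}, w ∉ base → SameStart w (g ^ len g)) :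
    s ∉ Subgroup.closure {a, b, g} := by
  intro hs
  have hsb : s ∉ base := by simpa using s_zpow_not_mem_base 1
  obtain ⟨c₀, hc₀, h₀⟩ := exists_sameStart_s hσ hg
  rcases exists_isAlternating hs with h | ⟨c, hc, d, hd, y, hy, h⟩
  · exact hsb h
  · obtain ⟨-, h2⟩ := hy.sameStart hσ hg hW
    have e : y⁻¹ = d * s⁻¹ * c := by rw [h]; group
    rw [e] at h2
    have h3 : SameStart (d * s⁻¹) (d * s⁻¹ * c) := by
      apply sameStart_mul_right _ hc
      rw [← len_eq_zero, len_mul_left hd, len_inv, len_s]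
      omega
    have h4 := (h3.trans (h2.trans h₀)).symm
    rw [← sameStart_mul_left_iff (inv_mem hc₀), inv_mul_cancel_left, ← mul_assoc] at h4
    apply not_sameStart_s_s_inv (mul_mem (inv_mem hc₀) hd) 1
    simpa using h4

/-- The length of `w * g * w⁻¹` is the displacement by `g` of the vertex of `w⁻¹`. That vertex turns
out to lie on the ray from the base vertex to the attracting end. By `hlt` the base vertex is off
the axis of `g`, so moving along this ray decreases the displacement. -/
theorem len_conj_lt (hlt : len (g ^ 2) < 2 * len g) {i j : ℕ} {m : ℤ}
    (hw : g ^ i * (a ^ 2) ^ m * (g ^ j)⁻¹ ∉ base)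
    (hs : ¬ SameStart (g ^ i * (a ^ 2) ^ m * (g ^ j)⁻¹) (g ^ len g)) :
    len ((g ^ i * (a ^ 2) ^ m * (g ^ j)⁻¹) * g * (g ^ i * (a ^ 2) ^ m * (g ^ j)⁻¹)⁻¹) < len g := by
  set w := g ^ i * (a ^ 2) ^ m * (g ^ j)⁻¹ with hwdef
  have hR : len w ≠ 0 := by rwa [Ne, len_eq_zero]
  have hmul (M : ℕ) : len (w * g ^ (M + j)) = len (g ^ (M + i)) := by
    have : w * g ^ (M + j) = g ^ (M + i) * (a ^ 2) ^ (2 ^ M * m) := by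
      rw [hwdef, add_comm M j, pow_add, mul_assoc, inv_mul_cancel_left, mul_assoc,
        a_sq_zpow_mul_pow hg, ← mul_assoc, ← pow_add, add_comm i M]
    rw [this, len_mul_right (a_sq_zpow_mem_base _)]
  have hinv (M : ℕ) : len (w⁻¹ * g ^ (M + i)) = len (g ^ (M + j)) := by
    have : w⁻¹ * g ^ (M + i) = g ^ (M + j) * (a ^ 2) ^ (2 ^ M * -m) := by
      rw [hwdef, add_comm M i, pow_add, mul_inv_rev, mul_inv_rev, inv_inv, mul_assoc, mul_assoc,
        inv_mul_cancel_left, ← zpow_neg,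
        a_sq_zpow_mul_pow hg, ← mul_assoc, ← pow_add, add_comm j M]
    rw [this, len_mul_right (a_sq_zpow_mem_base _)]
  have hsum (M : ℕ) (hM : len g ≤ M) : len (g ^ (M + j)) = len w + len (g ^ (M + i)) := by
    rw [← hinv]
    apply len_inv_mul_of_not_sameStart
    intro h
    exact hs (h.trans (sameStart_pow hσ (by omega)).symm)
  have hstep (N : ℕ) : len (g ^ (N + 1)) ≤ len (g ^ N) + len g ∧
      len (g ^ N) ≤ len (g ^ (N + 1)) + len g ∧ len (g ^ (N + 2)) < len (g ^ N) + 2 * len g := by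
    refine ⟨by rw [pow_succ]; exact len_mul_le _ _, ?_, ?_⟩
    · have := len_mul_le (g ^ (N + 1)) g⁻¹
      rwa [len_inv, pow_succ, mul_inv_cancel_right, ← pow_succ] at this
    · have := len_mul_le (g ^ N) (g ^ 2)
      rw [← pow_add] at this
      omega
  -- Otherwise consecutive lengths always differ by exactly `len g`; `hlt` forbids two increases in
  -- a row, so lengths two steps apart never grow, against `le_len_pow`.
  obtain ⟨M, hM, h1, h2⟩ : ∃ M, len g ≤ M ∧ len (g ^ (M + i + 1)) < len (g ^ (M + i)) + len g ∧
      len (g ^ (M + i)) < len (g ^ (M + i + 1)) + len g := by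
    by_contra! hcon
    have hdec (M : ℕ) (hM : len g ≤ M) : len (g ^ (M + i + 2)) ≤ len (g ^ (M + i)) := by
      have h1 := hcon M hM
      have h2 := hcon (M + 1) (by omega)
      rw [show M + 1 + i = M + i + 1 by ring] at h2
      have h3 := hstep (M + i)
      have h4 := hstep (M + i + 1)
      rw [show M + i + 1 + 1 = M + i + 2 by ring] at h2 h4
      by_cases h : len (g ^ (M + i + 1)) < len (g ^ (M + i)) + len g
      · have := h1 h
        omega
      · have := h2 (by omega)
        omega
    have hbound (k : ℕ) : len (g ^ (len g + i + 2 * k)) ≤ len (g ^ (len g + i)) := by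
      induction k with
      | zero => simp
      | succ k ih =>
        have := hdec (len g + 2 * k) (by omega)
        rw [show len g + i + 2 * (k + 1) = len g + 2 * k + i + 2 by ring]
        rw [show len g + i + 2 * k = len g + 2 * k + i by ring] at ih
        omega
    have h1 := hbound (len (g ^ (len g + i)))
    have h2 := le_len_pow hσ (len g + i + 2 * len (g ^ (len g + i)))
    have h3 := len_ne_zero_of_sExp hσ
    omega
  -- With `Δ = len (g ^ (M + i + 1)) - len (g ^ (M + i))`, the two inequalities bound the
  -- displacement by the largest of `-Δ`, `Δ` and `len g - 2 * len w`.
  have f1 := len_four_point w⁻¹ (g * w⁻¹) 1 (g ^ (M + 1 + j))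
  have f2 := len_four_point 1 (g * w⁻¹) g (g ^ (M + 1 + j))
  have e1 : (g * w⁻¹)⁻¹ * g ^ (M + 1 + j) = w * g ^ (M + j) := by
    rw [show M + 1 + j = M + j + 1 by ring, pow_succ']
    group
  have e2 : g⁻¹ * g ^ (M + 1 + j) = g ^ (M + j) := by
    rw [show M + 1 + j = M + j + 1 by ring, pow_succ']
    group
  have e3 : (g * w⁻¹)⁻¹ * g = w := by group
  rw [e1] at f1 f2
  rw [e2, e3] at f2
  simp only [inv_inv, inv_one, one_mul, mul_one, len_inv] at f1 f2
  rw [hmul, hmul, hsum _ (by omega)] at f1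
  rw [hmul, hsum _ (by omega), hsum _ (by omega)] at f2
  rw [show M + 1 + i = M + i + 1 by ring] at f1 f2
  rw [mul_assoc]
  omega

end

end HGroup

/-! ### Surjective endomorphisms fixing `a` and `b`. -/

namespace HGroup

theorem sExp_map_ne_one {f : HGroup →* HGroup} (hb : ∀ c ∈ base, f c ∈ base)
    (hf : Function.Surjective f) : sExp (f s) ≠ 1 := by
  intro h
  have h1 : sExp.comp f = 1 := by
    apply hom_ext
    · simpa using sExp_of_mem_base (hb a a_mem_base)
    · simpa using sExp_of_mem_base (hb b b_mem_base)
    · simpa using h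
  obtain ⟨x, hx⟩ := hf s
  have h2 := DFunLike.congr_fun h1 x
  rw [MonoidHom.comp_apply, hx, sExp_s] at h2
  simp at h2

theorem mem_closure_of_surjective {f : HGroup →* HGroup} (hf : Function.Surjective f)
    (x : HGroup) : x ∈ Subgroup.closure {f a, f b, f s} := by
  obtain ⟨x, rfl⟩ := hf x
  exact mem_of_generators (S := (Subgroup.closure {f a, f b, f s}).comap f)
    (Subgroup.subset_closure (by simp)) (Subgroup.subset_closure (by simp))
    (Subgroup.subset_closure (by simp)) x

/-- The automorphism fixing `a` and `b` and sending `s` to `s * c`, for `c ∈ ⟨a, b⟩`. -/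
def rightTwist {c : HGroup} (hc : c ∈ base) : HGroup →* HGroup :=
  lift a b (s * c) commute_a_b (by
    rw [← mul_assoc, a_sq_mul_s, mul_assoc, mul_assoc,
      mul_comm_of_mem_base hc (pow_mem a_mem_base 4)])

theorem base_le_range {θ : HGroup →* HGroup} (ha : θ a = a) (hb : θ b = b) : base ≤ θ.range := by
  intro c hc
  obtain ⟨i, j, rfl⟩ := mem_base.1 hc
  exact ⟨a ^ i * b ^ j, by simp [ha, hb]⟩

theorem rightTwist_surjective {c : HGroup} (hc : c ∈ base) :
    Function.Surjective (rightTwist hc) := by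
  have h := base_le_range (θ := rightTwist hc) (lift_a _ _ _ _ _) (lift_b _ _ _ _ _)
  refine surjective_of_generators (h a_mem_base) (h b_mem_base) ?_
  have : s * c ∈ (rightTwist hc).range := ⟨s, lift_s _ _ _ _ _⟩
  rwa [Subgroup.mul_mem_cancel_right _ (h hc)] at this

/-- Conjugating `a²` by `s ^ (-i)` gives a power of `a²`, which commutes with `(a ^ 2) ^ m`. -/
theorem a_sq_mul_conj (i : ℕ) (m : ℤ) :
    a ^ 2 * (s ^ i * (a ^ 2) ^ m * (s ^ i)⁻¹) = (s ^ i * (a ^ 2) ^ m * (s ^ i)⁻¹) * a ^ 2 := by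
  have h := a_sq_zpow_mul_pow (g := s) a_sq_mul_s 1 i
  rw [zpow_one, mul_one] at h
  have h' : (s ^ i)⁻¹ * a ^ 2 = (a ^ 2) ^ (2 ^ i : ℤ) * (s ^ i)⁻¹ := by
    rw [inv_mul_eq_iff_eq_mul, ← mul_assoc, ← h, mul_inv_cancel_right]
  have hc : (a ^ 2) ^ (2 ^ i : ℤ) * (a ^ 2) ^ m = (a ^ 2) ^ m * (a ^ 2) ^ (2 ^ i : ℤ) :=
    (Commute.zpow_zpow_self (a ^ 2) _ _).eq
  calc a ^ 2 * (s ^ i * (a ^ 2) ^ m * (s ^ i)⁻¹)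
      = a ^ 2 * s ^ i * (a ^ 2) ^ m * (s ^ i)⁻¹ := by simp only [mul_assoc]
    _ = s ^ i * ((a ^ 2) ^ (2 ^ i : ℤ) * (a ^ 2) ^ m) * (s ^ i)⁻¹ := by
      rw [h, mul_assoc (s ^ i)]
    _ = s ^ i * (a ^ 2) ^ m * ((s ^ i)⁻¹ * a ^ 2) := by
      rw [hc, h']
      simp only [mul_assoc]
    _ = _ := by simp only [mul_assoc]

/-- The automorphism fixing `a` and `b` and conjugating `s` by `s ^ i * a ^ (2 * m) * s ^ (-i)`. -/
def conjTwist (i : ℕ) (m : ℤ) : HGroup →* HGroup :=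
  lift a b ((s ^ i * (a ^ 2) ^ m * (s ^ i)⁻¹) * s * (s ^ i * (a ^ 2) ^ m * (s ^ i)⁻¹)⁻¹)
    commute_a_b (by
    have h := a_sq_mul_conj i m
    set q := s ^ i * (a ^ 2) ^ m * (s ^ i)⁻¹
    have h1 : SemiconjBy q (a ^ 2) (a ^ 2) := h.symm
    have h2 : SemiconjBy q (a ^ 4) (a ^ 4) := by
      simpa [← pow_mul] using h1.pow_right 2
    have h3 : SemiconjBy s (a ^ 4) (a ^ 2) := a_sq_mul_s.symm
    have h4 := (h1.mul_left (h3.mul_left h2.inv_symm_left)).eq.symm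
    rwa [← mul_assoc q s] at h4)

theorem conjTwist_surjective (i : ℕ) (m : ℤ) : Function.Surjective (conjTwist i m) := by
  have ha : conjTwist i m a = a := lift_a _ _ _ _ _
  have h := base_le_range ha (lift_b _ _ _ _ _)
  refine surjective_of_generators (h a_mem_base) (h b_mem_base) ?_
  set q := s ^ i * (a ^ 2) ^ m * (s ^ i)⁻¹ with hq
  have hs : conjTwist i m s = q * s * q⁻¹ := lift_s _ _ _ _ _
  -- Since `q` commutes with `a²` and is itself fixed, the image contains `q`, so `s` can be
  -- recovered from `q * s * q⁻¹`.
  have h1 : conjTwist i m q = q := by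
    have e : q * (s ^ i * (a ^ 2) ^ m * (s ^ i)⁻¹) * q⁻¹ = q := by rw [← hq]; group
    have hc : q⁻¹ * (a ^ 2) ^ m * q = (a ^ 2) ^ m := by
      have : Commute ((a ^ 2) ^ m) q := (Commute.zpow_left (a_sq_mul_conj i m) m)
      rw [mul_assoc, this.eq, inv_mul_cancel_left]
    conv_lhs => rw [hq]
    rw [map_mul, map_mul, map_inv, map_zpow, map_pow, map_pow, ha, hs, conj_pow]
    calc q * s ^ i * q⁻¹ * (a ^ 2) ^ m * (q * s ^ i * q⁻¹)⁻¹
        = q * s ^ i * (q⁻¹ * (a ^ 2) ^ m * q) * (s ^ i)⁻¹ * q⁻¹ := by group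
      _ = q * (s ^ i * (a ^ 2) ^ m * (s ^ i)⁻¹) * q⁻¹ := by rw [hc]; simp only [mul_assoc]
      _ = q := e
  have h2 : q * s * q⁻¹ ∈ (conjTwist i m).range := ⟨s, hs⟩
  have h3 : q ∈ (conjTwist i m).range := ⟨q, h1⟩
  rwa [Subgroup.mul_mem_cancel_right _ (inv_mem h3), Subgroup.mul_mem_cancel_left _ h3] at h2

theorem injective_of_comp_surjective {f θ : HGroup →* HGroup} (hθ : Function.Surjective θ)
    (h : Function.Injective (f.comp θ)) : Function.Injective f := by
  rw [injective_iff_map_eq_one] at h ⊢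
  intro x hx
  obtain ⟨y, rfl⟩ := hθ x
  rw [h y hx, map_one]

theorem map_mem_base_eq {f : HGroup →* HGroup} (ha : f a = a) (hb : f b = b) {c : HGroup}
    (hc : c ∈ base) : f c = c := by
  obtain ⟨i, j, rfl⟩ := mem_base.1 hc
  simp [ha, hb]

/-- The first edges towards `g` and `g⁻¹` have the types of `s` and `s⁻¹`, so `f` acts on directions
at the base vertex as faithfully as possible. The local criterion then applies with `δ = 0`. -/
theorem injective_of_no_folding {f : HGroup →* HGroup} (ha : f a = a) (hb : f b = b)
    (hσ : sExp (f s) ≠ 1)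
    (h : ∀ c ∈ base, ¬ SameStart (f s)⁻¹ (c * f s)) : Function.Injective f := by
  set g := f s with hg
  have hα : a ^ 2 * g = g * a ^ 4 := by
    have := congrArg f a_sq_mul_s
    simpa [ha] using this
  have hgb : g ∉ base := by simpa using pow_not_mem_base hσ one_ne_zero
  have hgb' : g⁻¹ ∉ base := by rwa [inv_mem_iff]
  -- the first edges at `g` and `g⁻¹`
  obtain ⟨c₁, hc₁, h₁⟩ : ∃ c₁ ∈ base, SameStart g (c₁ * s ^ ((1 : ℤˣ) : ℤ)) := by
    obtain ⟨c₁, hc₁, u, h₁⟩ := exists_sameStart_mul_s hgb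
    rcases Int.units_eq_one_or u with rfl | rfl
    · exact ⟨c₁, hc₁, h₁⟩
    · exfalso
      obtain ⟨k, hk⟩ := exists_zpow_of_sameStart_mul a_sq_mem_base hc₁ h₁
        (by rw [hα]; exact sameStart_mul_right hgb (pow_mem a_mem_base 4))
      rw [a_sq_eq_zpow] at hk
      have := a_zpow_injective hk
      simp only [edge, neg_neg, if_true] at this
      omega
  obtain ⟨c₂, hc₂, h₂⟩ : ∃ c₂ ∈ base, SameStart g⁻¹ (c₂ * s ^ ((-1 : ℤˣ) : ℤ)) := by
    obtain ⟨c₂, hc₂, u, h₂⟩ := exists_sameStart_mul_s hgb'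
    rcases Int.units_eq_one_or u with rfl | rfl
    · exfalso
      -- If both first edges were outgoing, an element of `⟨a, b⟩` would carry one to the other,
      -- which is a fold.
      have h3 := (sameStart_mul_left_iff (mul_mem hc₂ (inv_mem hc₁))).2 h₁
      rw [mul_assoc c₂ c₁⁻¹ (c₁ * _), inv_mul_cancel_left] at h3
      exact h _ (mul_mem hc₂ (inv_mem hc₁)) (h₂.trans h3.symm)
    · exact ⟨c₂, hc₂, h₂⟩
  apply injective_of_junction f (fun c hc => by rwa [map_mem_base_eq ha hb hc])
    (fun c hc h => by rwa [map_mem_base_eq ha hb hc] at h) 0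
    (by rw [← hg]; have := len_ne_zero_of_sExp hσ; omega)
  intro c hc u v hred
  rw [map_mem_base_eq ha hb hc, ← hg]
  have edge_case (u : ℤˣ) (k : ℤ) : s ^ (u : ℤ) * a ^ (edge u * k) * s ^ (-u : ℤ) ∈ base := by
    rw [edge_conj, mul_assoc, ← zpow_add, add_neg_cancel, zpow_zero, mul_one]
    exact a_zpow_mem_base _
  have key : ¬ SameStart (g ^ (u : ℤ))⁻¹ (c * g ^ (v : ℤ)) := by
    intro hs
    rcases Int.units_eq_one_or u with rfl | rfl <;> rcases Int.units_eq_one_or v with rfl | rfl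
    · exact h c hc (by simpa using hs)
    · obtain ⟨k, hk⟩ := exists_zpow_of_sameStart_mul hc hc₂ h₂ (by simpa using hs)
      rw [neg_neg] at hk
      exact hred (by rw [hk]; simpa using edge_case 1 k)
    · obtain ⟨k, hk⟩ := exists_zpow_of_sameStart_mul hc hc₁ h₁ (by simpa using hs)
      exact hred (by rw [hk]; simpa using edge_case (-1) k)
    · have h3 := ((sameStart_mul_left_iff (inv_mem hc)).2 hs).symm
      apply h c⁻¹ (inv_mem hc)
      simpa using h3
  rw [mul_assoc, len_mul_of_not_sameStart key, len_mul_left hc]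
  have hgu (u : ℤˣ) : len (g ^ (u : ℤ)) = len g := by
    rcases Int.units_eq_one_or u with rfl | rfl <;> simp
  rw [hgu, hgu]
  omega

theorem injective_of_map_eq_base (n : ℕ) : ∀ f : HGroup →* HGroup, f a = a → f b = b →
    Function.Surjective f → len (f s) = n → Function.Injective f := by
  induction n using Nat.strong_induction_on with
  | _ n ih =>
    intro f ha hb hf hn
    have fix {f : HGroup →* HGroup} (ha : f a = a) (hb : f b = b) : ∀ c ∈ base, f c ∈ base :=
      fun c hc => by rwa [map_mem_base_eq ha hb hc]
    by_cases hfold : ∀ c ∈ base, ¬ SameStart (f s)⁻¹ (c * f s)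
    · exact injective_of_no_folding ha hb (sExp_map_ne_one (fix ha hb) hf) hfold
    push Not at hfold
    obtain ⟨c, hc, hs⟩ := hfold
    apply injective_of_comp_surjective (rightTwist_surjective hc)
    set f₁ := f.comp (rightTwist hc) with hf₁
    have ha₁ : f₁ a = a := by simp [hf₁, rightTwist, ha]
    have hb₁ : f₁ b = b := by simp [hf₁, rightTwist, hb]
    have hs₁ : f₁ s = f s * c := by simp [hf₁, rightTwist, map_mem_base_eq ha hb hc]
    have hsurj : Function.Surjective f₁ := hf.comp (rightTwist_surjective hc)
    have hσ := sExp_map_ne_one (fix ha₁ hb₁) hsurj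
    set g := f₁ s with hg
    have hlen : len g = n := by rw [hs₁, len_mul_right hc, hn]
    have hα : a ^ 2 * g = g * a ^ 4 := by
      have := congrArg f₁ a_sq_mul_s
      simpa [ha₁] using this
    have hgb : g ∉ base := by simpa using pow_not_mem_base hσ one_ne_zero
    -- The twist by `c` turns a fold up to translation into an honest coincidence of first edges.
    have hfold : SameStart g⁻¹ g := by
      have h1 := (sameStart_mul_left_iff (inv_mem hc)).2 hs
      rw [inv_mul_cancel_left, ← mul_inv_rev, ← hs₁] at h1
      have h2 : SameStart (f s) (f s * c) := sameStart_mul_right h1.not_mem_base_right hc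
      rw [← hs₁] at h2
      exact h1.trans h2
    have hlt : len (g ^ 2) < 2 * len g := by
      unfold SameStart at hfold
      rw [inv_inv, len_inv, ← pow_two] at hfold
      omega
    by_cases hW : ∀ w ∈ Subgroup.closure {a ^ 2, g}, w ∉ base → SameStart w (g ^ len g)
    · exfalso
      apply s_not_mem_closure hσ hα hW
      have := mem_closure_of_surjective hsurj s
      rwa [ha₁, hb₁] at this
    push Not at hW
    obtain ⟨w, hw, hwb, hws⟩ := hW
    obtain ⟨i, j, m, rfl⟩ := exists_form_of_mem_closure hσ hα hw
    have hdesc := len_conj_lt hσ hα hlt hwb hws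
    apply injective_of_comp_surjective (conjTwist_surjective i m)
    -- The twist conjugates by `g ^ i * (a ^ 2) ^ m * (g ^ i)⁻¹`; this differs from `w` by a power
    -- of `g` on the right, invisible when conjugating `g`.
    have hconj : (f₁.comp (conjTwist i m)) s = g ^ i * (a ^ 2) ^ m * (g ^ j)⁻¹ * g *
        (g ^ i * (a ^ 2) ^ m * (g ^ j)⁻¹)⁻¹ := by
      simp only [conjTwist, MonoidHom.comp_apply, lift_s, map_mul, map_inv, map_pow, map_zpow, ha₁,
        ← hg]
      group
    exact ih _ (by rw [hconj]; omega) _ (by simp [conjTwist, ha₁]) (by simp [conjTwist, hb₁])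
      (hsurj.comp (conjTwist_surjective i m)) rfl

end HGroup

/-! ### Reduction of a general surjection to one fixing `a` and `b`. -/

namespace HGroup

/-- If `x` and `x⁻¹` shared a first edge, conjugating by its label `p` would shorten `x`. Parity of
the `s`-exponent improves `len (x * p) < len x + 1` to `len (x * p) < len x`. -/
theorem not_sameStart_inv_of_minimal {x : HGroup} (hx : x ∉ base)
    (hmin : ∀ h : HGroup, len x ≤ len (h⁻¹ * x * h)) : ¬ SameStart x⁻¹ x := by
  intro hs
  obtain ⟨c, hc, u, z, hxz, hl⟩ := exists_eq_mul_s_mul hx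
  set p := c * s ^ (u : ℤ) with hp
  have hlp : len p = 1 := by rw [hp, len_mul_left hc, len_s_zpow]
  have hz : p⁻¹ * x = z := by rw [hxz]; group
  have hxp : SameStart x p := by
    unfold SameStart
    rw [len_inv_mul_comm, hz, hlp]
    omega
  have h1 : len (x * p) < len x + 1 := by
    have := hs.trans hxp
    unfold SameStart at this
    rwa [inv_inv, len_inv, hlp] at this
  have hσp : (sExp p).toAdd = u := by
    rw [hp, map_mul, sExp_of_mem_base hc, one_mul, map_zpow, sExp_s, ← ofAdd_zsmul]
    simp
  have hσ : (sExp (x * p)).toAdd = (sExp x).toAdd + u := by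
    rw [map_mul, toAdd_mul, hσp]
  have h2 := sExp_bounds (x * p)
  have h3 := sExp_bounds x
  have h4 := len_four_point p (x * p) 1 x
  have h5 := hmin p
  rw [show (x * p)⁻¹ * x = p⁻¹ by group, hz, ← mul_assoc] at h4
  simp only [inv_one, one_mul, mul_one, len_inv] at h4
  rw [hσ] at h2
  have hu : (u : ℤ) = 1 ∨ (u : ℤ) = -1 := by
    rcases Int.units_eq_one_or u with rfl | rfl <;> simp
  -- For `len x = 1` the exponent sum of `x * p` is `±2`, too large for its length.
  by_cases hz0 : len z = 0
  · have hσx : (sExp x).toAdd = u := by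
      rw [hxz, map_mul, toAdd_mul, hσp, sExp_of_mem_base (len_eq_zero.1 hz0)]
      simp
    rw [hσx, abs_le] at h2
    omega
  · omega

theorem len_pow_of_not_sameStart {x : HGroup} (hx : x ∉ base) (h : ¬ SameStart x⁻¹ x) (N : ℕ) :
    len (x ^ (N + 1)) = (N + 1) * len x ∧ SameStart x (x ^ (N + 1)) := by
  induction N with
  | zero => simpa using sameStart_refl hx
  | succ N ih =>
    have h' : ¬ SameStart x⁻¹ (x ^ (N + 1)) := fun h1 => h (h1.trans ih.2.symm)
    rw [pow_succ' x (N + 1)]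
    refine ⟨?_, sameStart_mul_of_not_sameStart hx h'⟩
    rw [len_mul_of_not_sameStart h', ih.1]
    ring

/-- Lengths of powers of a shortest conjugate outside `⟨a, b⟩` grow linearly, while conjugating by a
fixed `y'` changes length by at most `2 * len y'`; conjugate powers with exponents in ratio `2` are
then impossible. -/
theorem exists_conj_mem_base {x y : HGroup} (hxy : x ^ 2 * y = y * x ^ 4) :
    ∃ h : HGroup, h⁻¹ * x * h ∈ base := by
  obtain ⟨h, hmin⟩ : ∃ h : HGroup, ∀ k : HGroup, len (h⁻¹ * x * h) ≤ len (k⁻¹ * x * k) := by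
    exact ⟨_, fun k => Function.argmin_le (fun h : HGroup => len (h⁻¹ * x * h)) k⟩
  refine ⟨h, ?_⟩
  by_contra hx
  set x' := h⁻¹ * x * h with hx'
  have hns : ¬ SameStart x'⁻¹ x' := by
    apply not_sameStart_inv_of_minimal hx
    intro k
    have := hmin (h * k)
    rwa [show (h * k)⁻¹ * x * (h * k) = k⁻¹ * x' * k by rw [hx']; group] at this
  set y' := h⁻¹ * y * h with hy'
  have hpow (n : ℕ) : x' ^ n = h⁻¹ * x ^ n * h := by
    rw [hx']
    simpa using conj_pow (a := h⁻¹) (b := x) (i := n)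
  have hxy' : SemiconjBy y' (x' ^ 4) (x' ^ 2) := by
    change y' * x' ^ 4 = x' ^ 2 * y'
    rw [hpow, hpow, hy']
    calc h⁻¹ * y * h * (h⁻¹ * x ^ 4 * h) = h⁻¹ * (y * x ^ 4) * h := by group
      _ = h⁻¹ * (x ^ 2 * y) * h := by rw [hxy]
      _ = h⁻¹ * x ^ 2 * h * (h⁻¹ * y * h) := by group
  have hN := hxy'.pow_right (len y' + 1)
  rw [← pow_mul, ← pow_mul] at hN
  have e : x' ^ (4 * (len y' + 1)) = y'⁻¹ * x' ^ (2 * (len y' + 1)) * y' := by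
    rw [mul_assoc, ← hN.eq, inv_mul_cancel_left]
  have h1 := (len_pow_of_not_sameStart hx hns (4 * len y' + 3)).1
  have h2 := (len_pow_of_not_sameStart hx hns (2 * len y' + 1)).1
  rw [show 4 * len y' + 3 + 1 = 4 * (len y' + 1) by ring, e] at h1
  rw [show 2 * len y' + 1 + 1 = 2 * (len y' + 1) by ring] at h2
  have h3 := len_mul_le (y'⁻¹ * x' ^ (2 * (len y' + 1))) y'
  have h4 := len_mul_le y'⁻¹ (x' ^ (2 * (len y' + 1)))
  rw [len_inv] at h4
  have h5 : 1 ≤ len x' := by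
    rw [Nat.one_le_iff_ne_zero, Ne, len_eq_zero]
    exact hx
  nlinarith

/-- Edge stabilizers at the base vertex are `⟨a²⟩` and `⟨a⁴⟩`, so `a` fixes no other vertex. -/
theorem mem_base_of_commute_a {h : HGroup} (hh : h * a = a * h) : h ∈ base := by
  by_contra hb
  obtain ⟨c₀, hc₀, u, hs⟩ := exists_sameStart_mul_s hb
  obtain ⟨k, hk⟩ := exists_zpow_of_sameStart_mul a_mem_base hc₀ hs
    (by rw [← hh]; exact sameStart_mul_right hb a_mem_base)
  have h1 : (1 : ℤ) = edge (-u) * k := a_zpow_injective (by simpa using hk)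
  rcases Int.units_eq_one_or u with rfl | rfl
  · simp only [edge] at h1
    rw [if_neg (by decide)] at h1
    omega
  · simp only [edge, neg_neg, if_true] at h1
    omega

/-! ### Finite affine quotients and the exponent of `f a`. -/

section affine

variable {R : Type*} [CommRing R]

variable (R) in
/-- The action of the units of a ring on its additive group. -/
def unitsMulAut : Rˣ →* MulAut (Multiplicative R) where
  toFun u :=
    { toFun x := Multiplicative.ofAdd (u * x.toAdd)
      invFun x := Multiplicative.ofAdd (↑u⁻¹ * x.toAdd)
      left_inv x := by simp
      right_inv x := by simp
      map_mul' x y := by simp [mul_add] }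
  map_one' := by ext; simp
  map_mul' u v := by ext; simp [mul_assoc]

/-- A homomorphism of `H` to the affine group of a ring. -/
def toAffine (l : Rˣ) (hl : (l : R) * 4 = 2) (c : R × R × R) :
    HGroup →* Multiplicative R ⋊[unitsMulAut R] Rˣ :=
  lift (SemidirectProduct.inl (Multiplicative.ofAdd c.1))
    (SemidirectProduct.inl (Multiplicative.ofAdd c.2.1)) ⟨Multiplicative.ofAdd c.2.2, l⟩
    ((Commute.all _ _).map _) (by
      rw [← map_pow SemidirectProduct.inl, ← map_pow SemidirectProduct.inl]
      refine SemidirectProduct.ext ?_ ?_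
      · apply Multiplicative.toAdd.injective
        change 2 • c.1 + ((1 : Rˣ) : R) * c.2.2 = c.2.2 + (l : R) * (4 • c.1)
        simp only [nsmul_eq_mul, Units.val_one]
        push_cast
        linear_combination (-c.1) * hl
      · change 1 * l = l * 1
        rw [one_mul, mul_one])

theorem toAffine_right (l : Rˣ) (hl : (l : R) * 4 = 2) (c c' : R × R × R) (x : HGroup) :
    (toAffine l hl c x).right = (toAffine l hl c' x).right := by
  have h : SemidirectProduct.rightHom.comp (toAffine l hl c) =
      SemidirectProduct.rightHom.comp (toAffine l hl c') := by
    apply hom_ext <;> simp [toAffine]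
  exact DFunLike.congr_fun h x

theorem toAffine_injective (l : Rˣ) (hl : (l : R) * 4 = 2) {c c' : R × R × R}
    (h : toAffine l hl c = toAffine l hl c') : c = c' := by
  have ha := congrArg SemidirectProduct.left (DFunLike.congr_fun h a)
  have hb := congrArg SemidirectProduct.left (DFunLike.congr_fun h b)
  have hs := congrArg SemidirectProduct.left (DFunLike.congr_fun h s)
  simp only [toAffine, lift_a, lift_b, lift_s, SemidirectProduct.left_inl] at ha hb hs
  exact Prod.ext (Multiplicative.ofAdd.injective ha)
    (Prod.ext (Multiplicative.ofAdd.injective hb) (Multiplicative.ofAdd.injective hs))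

/-- Composition with a surjection is injective on the `|R|³` homomorphisms `toAffine l hl c`. But
each composite kills `a`, so it is determined by two translation parts, with at most `|R|²` values.
-/
theorem not_surjective_of_intCast_eq_zero [Finite R] [Nontrivial R] (l : Rˣ)
    (hl : (l : R) * 4 = 2) {f : HGroup →* HGroup} {k : ℤ} (ha : f a = a ^ k) (hk : (k : R) = 0) :
    ¬ Function.Surjective f := by
  intro hf
  have := Fintype.ofFinite R
  have hcard : Fintype.card (R × R) < Fintype.card (R × R × R) := by
    have h1 : 1 < Fintype.card R := Fintype.one_lt_card
    rw [Fintype.card_prod, Fintype.card_prod, Fintype.card_prod]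
    nlinarith
  obtain ⟨c, c', hne, h⟩ := Fintype.exists_ne_map_eq_of_card_lt
    (fun c : R × R × R => ((toAffine l hl c (f b)).left.toAdd,
      (toAffine l hl c (f s)).left.toAdd)) hcard
  rw [Prod.mk.injEq] at h
  apply hne
  apply toAffine_injective l hl
  have hcomp : (toAffine l hl c).comp f = (toAffine l hl c').comp f := by
    apply hom_ext
    · have key (c : R × R × R) : toAffine l hl c (a ^ k) = 1 := by
        rw [map_zpow, toAffine, lift_a, ← map_zpow, ← ofAdd_zsmul, zsmul_eq_mul, hk]
        simp
      rw [MonoidHom.comp_apply, MonoidHom.comp_apply, ha, key, key]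
    · exact SemidirectProduct.ext (Multiplicative.toAdd.injective h.1) (toAffine_right l hl _ _ _)
    · exact SemidirectProduct.ext (Multiplicative.toAdd.injective h.2) (toAffine_right l hl _ _ _)
  refine MonoidHom.ext fun x => ?_
  obtain ⟨x, rfl⟩ := hf x
  exact DFunLike.congr_fun hcomp x

end affine

theorem isUnit_of_surjective {f : HGroup →* HGroup} {k : ℤ} (ha : f a = a ^ k)
    (hf : Function.Surjective f) : k = 1 ∨ k = -1 := by
  by_contra! hk
  -- The ring needs a unit `l` with `4 * l = 2`: take `l = 1` modulo `2` for even `k` (including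
  -- `0`), and `l = 1/2` modulo `|k|` for odd `k`.
  rcases Int.even_or_odd' k with ⟨j, hj | hj⟩
  · refine not_surjective_of_intCast_eq_zero (R := ZMod 2) 1 (by decide) ha ?_ hf
    rw [ZMod.intCast_zmod_eq_zero_iff_dvd _ 2]
    omega
  · have : NeZero k.natAbs := ⟨by omega⟩
    have : Fact (1 < k.natAbs) := ⟨by omega⟩
    have hcop : Nat.Coprime 2 k.natAbs := by
      rw [Nat.coprime_two_left, Int.natAbs_odd]
      exact ⟨j, hj⟩
    have h2 := (ZMod.unitOfCoprime 2 hcop).inv_mul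
    rw [ZMod.coe_unitOfCoprime] at h2
    push_cast at h2
    refine not_surjective_of_intCast_eq_zero (R := ZMod k.natAbs) (ZMod.unitOfCoprime 2 hcop)⁻¹
      (by linear_combination 2 * h2) ha ?_ hf
    rw [ZMod.intCast_zmod_eq_zero_iff_dvd]
    exact Int.natAbs_dvd.2 dvd_rfl

theorem injective_of_map_a {f : HGroup →* HGroup} {k : ℤ} (ha : f a = a ^ k)
    (hf : Function.Surjective f) : Function.Injective f := by
  have hk := isUnit_of_surjective ha hf
  have hk2 : k * k = 1 := by rcases hk with rfl | rfl <;> norm_num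
  have hb : f b ∈ base := by
    apply mem_base_of_commute_a
    have h1 : f b * a ^ k = a ^ k * f b := by
      rw [← ha, ← map_mul, ← map_mul, commute_a_b.eq]
    have h2 : Commute (f b) (a ^ k) := h1
    have h3 := h2.zpow_right k
    rw [← zpow_mul, hk2, zpow_one] at h3
    exact h3.eq
  have hbase : ∀ c ∈ base, f c ∈ base := by
    intro c hc
    obtain ⟨i, j, rfl⟩ := mem_base.1 hc
    rw [map_mul, map_zpow, map_zpow, ha]
    exact mul_mem (zpow_mem (a_zpow_mem_base k) i) (zpow_mem hb j)
  obtain ⟨i, l, hbl⟩ := mem_base.1 hb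
  have hσ := sExp_map_ne_one hbase hf
  have hσf : sExp.comp f = (zpowGroupHom (sExp (f s)).toAdd).comp sExp := by
    apply hom_ext
    · simp [sExp_of_mem_base (hbase a a_mem_base), sExp_of_mem_base a_mem_base]
    · simp [sExp_of_mem_base (hbase b b_mem_base), sExp_of_mem_base b_mem_base]
    · apply Multiplicative.toAdd.injective
      simp
  have hβf : bExp.comp f = (zpowGroupHom l).comp bExp *
      (zpowGroupHom (bExp (f s)).toAdd).comp sExp := by
    apply hom_ext
    · simp [ha, bExp, sExp]
    · simp [hbl, bExp, sExp]
    · apply Multiplicative.toAdd.injective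
      simp [bExp, sExp]
  -- A preimage of `b` has `s`-exponent zero, so comparing `b`-exponents makes `l` a unit of `ℤ`.
  obtain ⟨x, hx⟩ := hf b
  have h1 := DFunLike.congr_fun hσf x
  have h2 := DFunLike.congr_fun hβf x
  simp only [MonoidHom.comp_apply, MonoidHom.mul_apply, hx, zpowGroupHom_apply] at h1 h2
  rw [sExp_of_mem_base b_mem_base] at h1
  have h3 : sExp x = 1 := by
    apply Multiplicative.toAdd.injective
    have h4 := congrArg Multiplicative.toAdd h1
    rw [toAdd_one, toAdd_zpow, smul_eq_mul, eq_comm, mul_eq_zero] at h4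
    rcases h4 with h4 | h4
    · exact absurd h4 (by simpa using hσ)
    · simpa using h4
  rw [h3, one_zpow, mul_one] at h2
  have hl : l = 1 ∨ l = -1 := by
    have h4 := congrArg Multiplicative.toAdd h2
    simp only [bExp, lift_b, toAdd_ofAdd, toAdd_zpow, smul_eq_mul] at h4
    exact Int.isUnit_iff.1 (IsUnit.of_mul_eq_one _ h4.symm)
  have hl2 : l * l = 1 := by rcases hl with rfl | rfl <;> norm_num
  set θ : HGroup →* HGroup := lift (a ^ k) (a ^ (-(k * i * l)) * b ^ l) s
    (mul_comm_of_mem_base (a_zpow_mem_base k) (mem_base.2 ⟨_, _, rfl⟩)) (by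
      have h := a_sq_zpow_mul_s k
      rwa [← zpow_natCast a 2, ← zpow_natCast a 4, ← zpow_mul, ← zpow_mul, mul_comm,
        mul_comm _ k, zpow_mul, zpow_mul, zpow_natCast, zpow_natCast] at h) with hθ
  have hθa : θ a = a ^ k := lift_a _ _ _ _ _
  have hθb : θ b = a ^ (-(k * i * l)) * b ^ l := lift_b _ _ _ _ _
  have hθs : θ s = s := lift_s _ _ _ _ _
  have hsurj : Function.Surjective θ := by
    have ha' : a ∈ θ.range := ⟨a ^ k, by rw [map_zpow, hθa, ← zpow_mul, hk2, zpow_one]⟩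
    refine surjective_of_generators ha' ?_ ⟨s, hθs⟩
    have h4 : b ^ l ∈ θ.range := by
      have : θ b ∈ θ.range := ⟨b, rfl⟩
      rwa [hθb, Subgroup.mul_mem_cancel_left _ (zpow_mem ha' _)] at this
    have h5 := zpow_mem h4 l
    rwa [← zpow_mul, hl2, zpow_one] at h5
  apply injective_of_comp_surjective hsurj
  refine injective_of_map_eq_base _ (f.comp θ) ?_ ?_ (hf.comp hsurj) rfl
  · rw [MonoidHom.comp_apply, hθa, map_zpow, ha, ← zpow_mul, hk2, zpow_one]
  · rw [MonoidHom.comp_apply, hθb, map_mul, map_zpow, map_zpow, ha, hbl,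
      (commute_a_b.zpow_zpow i l).mul_zpow, ← mul_assoc, ← zpow_mul, ← zpow_mul, ← zpow_mul,
      ← zpow_add, hl2, zpow_one,
      show k * -(k * i * l) + i * l = 0 by linear_combination (-i * l) * hk2, zpow_zero, one_mul]

theorem isHopfian : IsHopfianGroup HGroup := by
  intro f hf
  refine ⟨?_, hf⟩
  have hrel : f a ^ 2 * f s = f s * f a ^ 4 := by
    have := congrArg f a_sq_mul_s
    simpa using this
  obtain ⟨h, hh⟩ := exists_conj_mem_base hrel
  set f' := (MulAut.conj h⁻¹).toMonoidHom.comp f with hf'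
  have hsurj : Function.Surjective f' := (MulAut.conj h⁻¹).surjective.comp hf
  have hfa : f' a ∈ base := by simpa [hf'] using hh
  obtain ⟨i, j, hij⟩ := mem_base.1 hfa
  -- The relation gives `2 * j = 4 * j` on `b`-exponents.
  have hj : j = 0 := by
    have h1 := congrArg (fun x => (bExp (f' x)).toAdd) a_sq_mul_s
    simp only [map_mul, map_pow, toAdd_mul, toAdd_pow, hij, map_zpow, toAdd_zpow] at h1
    simp [bExp] at h1
    omega
  have hinj : Function.Injective f' := injective_of_map_a (k := i) (by rw [hij, hj]; simp) hsurj
  exact Function.Injective.of_comp (f := MulAut.conj h⁻¹) hinj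

end HGroup

/-! ### The injective endomorphism `stableEnd`, and a nontrivial commutator. -/

namespace HGroup

theorem len_prod_of_reduced {r : List (ℤˣ × ℤ × ℤ)}
    (hr : r.IsChain fun p q => edge p.1 ∣ p.2.1 → p.2.2 = 0 → p.1 = q.1) :
    len (r.map fun p => s ^ (p.1 : ℤ) * (a ^ p.2.1 * b ^ p.2.2)).prod = r.length := by
  have h := HNNExtension.len_prod (φ := sqrtEquiv)
    ⟨1, r.map fun p => (p.1, Multiplicative.ofAdd p.2), by
      rw [List.isChain_map]
      refine hr.imp fun p q h hp => ?_
      rcases Int.units_eq_one_or p.1 with hu | hu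
      · simp only [hu, HNNExtension.toSubgroup_one, mem_fourthSubgroup] at hp
        exact h (by simpa [edge, hu] using hp.1) hp.2
      · simp only [hu, HNNExtension.toSubgroup_neg_one, mem_sqSubgroup] at hp
        exact h (by simpa [edge, hu] using hp.1) hp.2⟩
  rw [List.length_map] at h
  rw [← h, len, map_list_prod, List.map_map, HNNExtension.NormalWord.ReducedWord.prod,
    map_one, one_mul, List.map_map]
  congr 3
  funext p
  simp only [Function.comp_apply]
  rw [map_mul, map_zpow, toHNN_s, ← toHNN_ofBase]
  rfl

/-- The endomorphism `a ↦ a²`, `b ↦ b`, `s ↦ s⁻¹ b s²`. -/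
def stableEnd : HGroup →* HGroup :=
  lift (a ^ 2) b (s⁻¹ * b * s ^ 2) (commute_a_b.pow_left 2) (by
    have h1 : s * (a ^ 2) ^ 4 = (a ^ 2) ^ 2 * s := by
      rw [← pow_mul, ← pow_mul]
      exact_mod_cast s_mul_a_four_mul 2
    have h2 : s * (a ^ 2) ^ 2 = a ^ 2 * s := by
      rw [← pow_mul]
      exact_mod_cast s_mul_a_four_mul 1
    have h3 : b * a ^ 2 = a ^ 2 * b := (commute_a_b.pow_left 2).symm.eq
    have h4 : (a ^ 2) ^ 2 * s⁻¹ = s⁻¹ * a ^ 2 := by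
      rw [mul_inv_eq_iff_eq_mul, mul_assoc, ← h2, inv_mul_cancel_left]
    rw [← mul_assoc, ← mul_assoc, h4, mul_assoc s⁻¹, ← h3, pow_two s]
    simp only [mul_assoc]
    rw [h1, ← mul_assoc s ((a ^ 2) ^ 2), h2, mul_assoc])

@[simp] theorem stableEnd_a : stableEnd a = a ^ 2 := lift_a _ _ _ _ _
@[simp] theorem stableEnd_b : stableEnd b = b := lift_b _ _ _ _ _
@[simp] theorem stableEnd_s : stableEnd s = s⁻¹ * b * s ^ 2 := lift_s _ _ _ _ _

theorem stableEnd_base (i j : ℤ) : stableEnd (a ^ i * b ^ j) = a ^ (2 * i) * b ^ j := by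
  rw [map_mul, map_zpow, map_zpow, stableEnd_a, stableEnd_b, zpow_mul]
  rfl

theorem s_mul_s_inv_mem_base (k : ℤ) : s * a ^ (4 * k) * s⁻¹ = a ^ (2 * k) := by
  rw [s_mul_a_four_mul, mul_inv_cancel_right]

theorem s_inv_mul_s_mem_base (k : ℤ) : s⁻¹ * a ^ (2 * k) * s = a ^ (4 * k) := by
  rw [mul_assoc, ← s_mul_a_four_mul, inv_mul_cancel_left]

theorem len_stableEnd_s : len (stableEnd s) = 3 := by
  have h := len_prod_of_reduced (r := [(-1, 0, 1), (1, 0, 0), (1, 0, 0)]) (by simp)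
  rw [stableEnd_s]
  simpa [mul_assoc, pow_two] using h

/-- At most one pair of letters cancels, so the length drops from `6` to no less than `4`: a second
cancellation is blocked by a letter `b ^ (±1)` or, for `u = 1`, `v = -1`, by the hypothesis on `c`.
-/
theorem le_len_stableEnd_junction {c : HGroup} (hc : c ∈ base) (u v : ℤˣ)
    (h : s ^ (u : ℤ) * c * s ^ (v : ℤ) ∉ base) :
    4 ≤ len (stableEnd s ^ (u : ℤ) * stableEnd c * stableEnd s ^ (v : ℤ)) := by
  obtain ⟨i, j, rfl⟩ := mem_base.1 hc
  rw [stableEnd_base, stableEnd_s]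
  have long (w : List (ℤˣ × ℤ × ℤ)) {x : HGroup} (hw : 4 ≤ w.length)
      (hr : w.IsChain fun p q => edge p.1 ∣ p.2.1 → p.2.2 = 0 → p.1 = q.1)
      (hx : x = (w.map fun p => s ^ (p.1 : ℤ) * (a ^ p.2.1 * b ^ p.2.2)).prod) :
      4 ≤ len x := by
    rwa [hx, len_prod_of_reduced hr]
  by_cases hij : 4 ∣ 2 * i ∧ j = 0
  · obtain ⟨⟨k, hk⟩, rfl⟩ := hij
    have hs' : s * a ^ (2 * i) * s⁻¹ = a ^ (2 * k) := by
      rw [hk, s_mul_s_inv_mem_base]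
    rcases Int.units_eq_one_or u with rfl | rfl <;> rcases Int.units_eq_one_or v with rfl | rfl
    · refine long [(-1, 0, 1), (1, 2 * k, 1), (1, 0, 0), (1, 0, 0)] (by simp) (by simp) ?_
      trans s⁻¹ * b * s * (s * a ^ (2 * i) * s⁻¹) * b * s ^ 2
      · simp [mul_assoc, pow_two]
      · rw [hs']
        simp [mul_assoc, pow_two]
    · refine long [(-1, 0, 1), (1, 2 * k, 0), (-1, 0, -1), (1, 0, 0)] (by simp) ?_ ?_
      -- A second cancellation needs `k` even, that is `4 ∣ i`, and then the original word was not
      -- reduced.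
      · have : ¬ 2 ∣ k := by
          rintro ⟨m, rfl⟩
          apply h
          have : i = 4 * m := by omega
          simp [this, s_mul_s_inv_mem_base, a_zpow_mem_base]
        have : ¬ 4 ∣ 2 * k := by omega
        simp [edge, this]
      · trans s⁻¹ * b * s * (s * a ^ (2 * i) * s⁻¹) * s⁻¹ * b⁻¹ * s
        · simp [mul_assoc, pow_two]
        · rw [hs']
          simp [mul_assoc]
    · exfalso
      apply h
      have : i = 2 * k := by omega
      simp [this, s_inv_mul_s_mem_base, a_zpow_mem_base]
    · refine long [(-1, 0, 0), (-1, 2 * k, -1), (-1, 0, -1), (1, 0, 0)] (by simp) (by simp) ?_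
      trans (s ^ 2)⁻¹ * (b⁻¹ * (s * a ^ (2 * i) * s⁻¹)) * s⁻¹ * b⁻¹ * s
      · simp [mul_assoc, pow_two]
      · rw [hs', mul_comm_of_mem_base (inv_mem b_mem_base) (a_zpow_mem_base _)]
        simp [mul_assoc, pow_two]
  · have hc : 4 ∣ 2 * i → j ≠ 0 := fun h1 h2 => hij ⟨h1, h2⟩
    rcases Int.units_eq_one_or u with rfl | rfl <;> rcases Int.units_eq_one_or v with rfl | rfl
    · refine long [(-1, 0, 1), (1, 0, 0), (1, 2 * i, j), (-1, 0, 1), (1, 0, 0), (1, 0, 0)]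
        (by simp) (by simpa [edge]) ?_
      simp [pow_two, mul_assoc]
    · refine long [(-1, 0, 1), (1, 0, 0), (1, 2 * i, j), (-1, 0, 0), (-1, 0, -1), (1, 0, 0)]
        (by simp) (by simpa [edge]) ?_
      simp [pow_two, mul_assoc]
    · refine long [(-1, 0, 0), (-1, 0, -1), (1, 2 * i, j), (-1, 0, 1), (1, 0, 0), (1, 0, 0)]
        (by simp) (by simpa [edge]) ?_
      simp [pow_two, mul_assoc]
    · refine long [(-1, 0, 0), (-1, 0, -1), (1, 2 * i, j), (-1, 0, 0), (-1, 0, -1), (1, 0, 0)]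
        (by simp) (by simpa [edge]) ?_
      simp [pow_two, mul_assoc]

theorem stableEnd_injective : Function.Injective stableEnd := by
  refine injective_of_junction stableEnd ?_ ?_ 1 (by rw [len_stableEnd_s]; norm_num) ?_
  · intro c hc
    obtain ⟨i, j, rfl⟩ := mem_base.1 hc
    exact mem_base.2 ⟨_, _, stableEnd_base i j⟩
  · intro c hc h
    obtain ⟨i, j, rfl⟩ := mem_base.1 hc
    rw [stableEnd_base] at h
    obtain ⟨h1, rfl⟩ := base_ext (i' := 0) (j' := 0) (by simpa using h)
    obtain rfl : i = 0 := by omega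
    simp
  · intro c hc u v h
    have := le_len_stableEnd_junction hc u v h
    rw [len_stableEnd_s]
    omega

theorem commutator_ne_one : s⁻¹ * a * s * a * s⁻¹ * a⁻¹ * s * a⁻¹ ≠ 1 := by
  intro h
  have h' := len_prod_of_reduced (r := [(-1, 1, 0), (1, 1, 0), (-1, -1, 0), (1, -1, 0)])
    (by simp [edge])
  rw [show (List.map (fun p : ℤˣ × ℤ × ℤ => s ^ (p.1 : ℤ) * (a ^ p.2.1 * b ^ p.2.2))
    [(-1, 1, 0), (1, 1, 0), (-1, -1, 0), (1, -1, 0)]).prod = 1 by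
      rw [← h]; simp [mul_assoc]] at h'
  simp at h'

end HGroup

/-! ### `G` as the ascending HNN-extension, and its failure to be Hopfian. -/

namespace GGroup

open HGroup (stableEnd stableEnd_injective)

theorem commute_a_b : Commute a b := by
  have h : (b⁻¹ * a * b * a⁻¹ : GGroup) = 1 :=
    PresentedGroup.one_of_mem (rels := GRels) (x := (FreeGroup.of GGen.b)⁻¹ *
      FreeGroup.of GGen.a * FreeGroup.of GGen.b * (FreeGroup.of GGen.a)⁻¹) (by simp [GRels])
  have h' : b⁻¹ * a * b = a := by rwa [mul_inv_eq_one] at h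
  calc a * b = b * (b⁻¹ * a * b) := by group
    _ = b * a := by rw [h']

theorem a_sq_mul_s : a ^ 2 * s = s * a ^ 4 := by
  have h : (s⁻¹ * a ^ 2 * s * (a ^ 4)⁻¹ : GGroup) = 1 :=
    PresentedGroup.one_of_mem (rels := GRels) (x := (FreeGroup.of GGen.s)⁻¹ *
      FreeGroup.of GGen.a ^ 2 * FreeGroup.of GGen.s * (FreeGroup.of GGen.a ^ 4)⁻¹)
      (by simp [GRels])
  rw [mul_inv_eq_one, mul_assoc] at h
  exact eq_mul_of_inv_mul_eq h

theorem t_conj_a : t⁻¹ * a * t = a ^ 2 :=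
  mul_inv_eq_one.1 <| PresentedGroup.one_of_mem (rels := GRels) (x := (FreeGroup.of GGen.t)⁻¹ *
    FreeGroup.of GGen.a * FreeGroup.of GGen.t * (FreeGroup.of GGen.a ^ 2)⁻¹) (by simp [GRels])

theorem t_conj_b : t⁻¹ * b * t = b :=
  mul_inv_eq_one.1 <| PresentedGroup.one_of_mem (rels := GRels) (x := (FreeGroup.of GGen.t)⁻¹ *
    FreeGroup.of GGen.b * FreeGroup.of GGen.t * (FreeGroup.of GGen.b)⁻¹) (by simp [GRels])

theorem t_conj_s : t⁻¹ * s * t = s⁻¹ * b * s ^ 2 :=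
  mul_inv_eq_one.1 <| PresentedGroup.one_of_mem (rels := GRels) (x := (FreeGroup.of GGen.t)⁻¹ *
    FreeGroup.of GGen.s * FreeGroup.of GGen.t *
      ((FreeGroup.of GGen.s)⁻¹ * FreeGroup.of GGen.b * FreeGroup.of GGen.s ^ 2)⁻¹)
    (by simp [GRels])

section lift

variable {K : Type*} [Group K] (x y z w : K)

/-- The homomorphism out of `G` with prescribed values on the generators. -/
def lift (hxy : y⁻¹ * x * y = x) (hxz : z⁻¹ * x ^ 2 * z = x ^ 4) (hx : w⁻¹ * x * w = x ^ 2)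
    (hy : w⁻¹ * y * w = y) (hz : w⁻¹ * z * w = z⁻¹ * y * z ^ 2) : GGroup →* K :=
  PresentedGroup.toGroup (f := fun g => GGen.casesOn g x y z w) (by
    intro r hr
    rcases hr with rfl | rfl | rfl | rfl | rfl <;>
      simp only [map_mul, map_inv, map_pow, FreeGroup.lift_apply_of] <;>
      rw [mul_inv_eq_one] <;> assumption)

variable (hxy : y⁻¹ * x * y = x) (hxz : z⁻¹ * x ^ 2 * z = x ^ 4) (hx : w⁻¹ * x * w = x ^ 2)
    (hy : w⁻¹ * y * w = y) (hz : w⁻¹ * z * w = z⁻¹ * y * z ^ 2)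

@[simp] theorem lift_a : lift x y z w hxy hxz hx hy hz a = x := PresentedGroup.toGroup.of _
@[simp] theorem lift_b : lift x y z w hxy hxz hx hy hz b = y := PresentedGroup.toGroup.of _
@[simp] theorem lift_s : lift x y z w hxy hxz hx hy hz s = z := PresentedGroup.toGroup.of _
@[simp] theorem lift_t : lift x y z w hxy hxz hx hy hz t = w := PresentedGroup.toGroup.of _

variable {x y z w}

theorem hom_ext {f g : GGroup →* K} (ha : f a = g a) (hb : f b = g b) (hs : f s = g s)
    (ht : f t = g t) : f = g :=
  PresentedGroup.ext (by rintro (_ | _ | _ | _) <;> assumption)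

end lift

/-- The natural map from `H` to `G`. -/
def ofH : HGroup →* GGroup :=
  HGroup.lift a b s commute_a_b a_sq_mul_s

@[simp] theorem ofH_a : ofH HGroup.a = a := HGroup.lift_a _ _ _ _ _
@[simp] theorem ofH_b : ofH HGroup.b = b := HGroup.lift_b _ _ _ _ _
@[simp] theorem ofH_s : ofH HGroup.s = s := HGroup.lift_s _ _ _ _ _

theorem t_conj_ofH (h : HGroup) : t⁻¹ * ofH h * t = ofH (stableEnd h) := by
  have : (MulAut.conj t⁻¹).toMonoidHom.comp ofH = ofH.comp stableEnd := by
    apply HGroup.hom_ext <;> simp [t_conj_a, t_conj_b, t_conj_s]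
  simpa using DFunLike.congr_fun this h

/-- The map from `G` to the ascending HNN-extension of `H` along `stableEnd`. -/
noncomputable def toAscending : GGroup →* AscendingHNN stableEnd stableEnd_injective :=
  lift (HNNExtension.of HGroup.a) (HNNExtension.of HGroup.b) (HNNExtension.of HGroup.s)
    HNNExtension.t
    (by simp only [← map_inv, ← map_mul]
        rw [mul_assoc, HGroup.commute_a_b.eq, inv_mul_cancel_left])
    (by simp only [← map_inv, ← map_mul, ← map_pow]
        rw [mul_assoc, HGroup.a_sq_mul_s, inv_mul_cancel_left])
    (by rw [AscendingHNN.conj]; simp)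
    (by rw [AscendingHNN.conj]; simp)
    (by rw [AscendingHNN.conj]; simp)

/-- The inverse of `toAscending`. -/
noncomputable def ofAscending : AscendingHNN stableEnd stableEnd_injective →* GGroup :=
  HNNExtension.lift ofH t (by
    rintro ⟨_, h, rfl⟩
    have e : (MonoidHom.ofInjective stableEnd_injective).symm ⟨stableEnd h, h, rfl⟩ = h :=
      (MonoidHom.ofInjective stableEnd_injective).symm_apply_apply h
    simp only [MulEquiv.trans_apply, e, Subgroup.topEquiv_symm_apply_coe]
    rw [← t_conj_ofH]
    group)

/-- The group `G` is the ascending HNN-extension of `H` along `stableEnd`. -/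
noncomputable def equivAscending : GGroup ≃* AscendingHNN stableEnd stableEnd_injective :=
  MonoidHom.toMulEquiv toAscending ofAscending
    (by apply hom_ext <;> simp [toAscending, ofAscending])
    (by
      apply HNNExtension.hom_ext
      · apply HGroup.hom_ext <;> simp [toAscending, ofAscending]
      · simp [toAscending, ofAscending])

theorem equivAscending_a : equivAscending a = HNNExtension.of HGroup.a :=
  show toAscending a = _ from lift_a ..

theorem equivAscending_b : equivAscending b = HNNExtension.of HGroup.b :=
  show toAscending b = _ from lift_b ..

theorem equivAscending_s : equivAscending s = HNNExtension.of HGroup.s :=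
  show toAscending s = _ from lift_s ..

theorem equivAscending_t : equivAscending t = HNNExtension.t :=
  show toAscending t = _ from lift_t ..

theorem toAscending_ofH (h : HGroup) : toAscending (ofH h) = HNNExtension.of h := by
  have : toAscending.comp ofH = HNNExtension.of := by
    apply HGroup.hom_ext <;> simp [toAscending]
  exact DFunLike.congr_fun this h

theorem ofH_injective : Function.Injective ofH := by
  intro x y h
  apply HNNExtension.of_injective (φ := ((MonoidHom.ofInjective stableEnd_injective).symm.trans
    Subgroup.topEquiv.symm))
  exact (toAscending_ofH x).symm.trans ((congrArg toAscending h).trans (toAscending_ofH y))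

/-- The endomorphism `a ↦ a²` fixing the other generators. -/
def squareEnd : GGroup →* GGroup :=
  lift (a ^ 2) b s t
    (by rw [mul_assoc, (commute_a_b.pow_left 2).eq, inv_mul_cancel_left])
    (by
      have h : SemiconjBy s (a ^ 4) (a ^ 2) := a_sq_mul_s.symm
      rw [mul_assoc, ← (h.pow_right 2).eq, inv_mul_cancel_left, ← pow_mul, ← pow_mul])
    (by
      have h : SemiconjBy t (a ^ 2) a := by
        rw [← t_conj_a]; simp [SemiconjBy, mul_assoc]
      rw [mul_assoc, ← (h.pow_right 2).eq, inv_mul_cancel_left])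
    t_conj_b t_conj_s

/-- Conjugation by `t` supplies the missing square root: `t * a ^ 2 * t⁻¹ = a`. -/
theorem squareEnd_surjective : Function.Surjective squareEnd := by
  intro x
  refine PresentedGroup.generated_by GRels squareEnd.range ?_ x
  rintro (_ | _ | _ | _)
  · refine ⟨t * a * t⁻¹, ?_⟩
    change _ = a
    simp only [map_mul, map_inv, squareEnd, lift_a, lift_t]
    rw [← t_conj_a]
    group
  · exact ⟨b, lift_b ..⟩
  · exact ⟨s, lift_s ..⟩
  · exact ⟨t, lift_t ..⟩

/-- The commutator of `s⁻¹ * a * s` and `a` is nontrivial in `H`, but is sent to that of `s⁻¹ * a ^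
2 * s = a ^ 4` and `a ^ 2`, which is trivial. -/
theorem not_isHopfian : ¬ IsHopfianGroup GGroup := by
  intro h
  have hinj := (h squareEnd squareEnd_surjective).1
  apply HGroup.commutator_ne_one
  apply ofH_injective
  apply hinj
  have h4 : s⁻¹ * a ^ 2 * s = a ^ 4 := by
    rw [mul_assoc, a_sq_mul_s, inv_mul_cancel_left]
  have h4' : s⁻¹ * ((a ^ 2)⁻¹ * s) = (a ^ 4)⁻¹ := by rw [← h4]; group
  simp only [map_mul, map_inv, map_one, ofH_a, ofH_s, squareEnd, lift_a, lift_s]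
  rw [h4, mul_assoc _ (a ^ 2)⁻¹ s, mul_assoc _ s⁻¹, h4']
  group

end GGroup

instance : Finite HGen :=
  Finite.of_injective (fun g : HGen => (HGen.casesOn g 0 1 2 : Fin 3)) (by
    rintro (_ | _ | _) (_ | _ | _) h <;> simp_all)

instance : Finite HRels := by
  unfold HRels
  infer_instance

theorem theorem1p1 :
    Group.IsFinitelyPresented HGroup ∧
    IsHopfianGroup HGroup ∧
    (∃ (φ : HGroup →* HGroup) (hφ : Function.Injective φ),
      φ HGroup.a = HGroup.a ^ 2 ∧
      φ HGroup.b = HGroup.b ∧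
      φ HGroup.s = HGroup.s⁻¹ * HGroup.b * HGroup.s ^ 2 ∧
      ∃ e : GGroup ≃* AscendingHNN φ hφ,
        e GGroup.a = HNNExtension.of HGroup.a ∧
        e GGroup.b = HNNExtension.of HGroup.b ∧
        e GGroup.s = HNNExtension.of HGroup.s ∧
        e GGroup.t = HNNExtension.t) ∧
    ¬ IsHopfianGroup GGroup :=
  ⟨inferInstance, HGroup.isHopfian,
    ⟨HGroup.stableEnd, HGroup.stableEnd_injective, HGroup.stableEnd_a, HGroup.stableEnd_b,
      HGroup.stableEnd_s, GGroup.equivAscending, GGroup.equivAscending_a, GGroup.equivAscending_b,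
      GGroup.equivAscending_s, GGroup.equivAscending_t⟩,
    GGroup.not_isHopfian⟩
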